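/- For $n\ge 1$ let $\mathcal V_n=\{-1,1\}^n$ be the vertex set of the $n$-dimensional hypercube (two vertices are adjacent iff they differ in exactly one coordinate), and let $d$ denote the Hamming distance. Let $I(u)=u\log u+(1-u)\log(1-u)+\log 2$ for $u\in[0,1]$ (with $0\log 0=0$) and, for $\gamma\in(1/2,1)$, let $\omega(\gamma)$ be the unique solution in $[0,1/2]$ of $I(\omega)=(2\gamma-1)\log 2$. Let $\gamma\in(1/2,1)$, $\rho\in(0,\infty)$ and $\varepsilon>0$, and let $A_n\subset\mathcal V_n$, $n\ge 1$, be sets with $|A_n|=\rho_n2^n$, where $\lim_{n\to\infty}\rho_n2^{\gamma n}=\rho$, such that $$d(x,y)\ge(\omega(\gamma)+\varepsilon)\,n\qquad\text{for all } n\ge 1 \text{ and all } x,y\in A_n,\ x\ne y.$$ Let $\mathbb P_x$, $\mathbb E_x$ refer to the discrete-time simple random walk $(Y_n(j))_{j\ge0}$ on the hypercube started at $x$, and for $B\subset\mathcal V_n$ let $H(B)=\inf\{j\ge0: Y_n(j)\in B\}$ be the hitting time of $B$ (with $\inf\emptyset=\infty$). Then for all $s\ge0$ $$\lim_{n\to\infty}\max_{x\in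 A_n}\Big|\mathbb E_x\Big[\exp\Big(-\frac{s}{2^{\gamma n}}H(A_n\setminus\{x\})\Big)\Big]-\frac{\rho}{s+\rho}\Big|=0 .$$ Consequently the rescaled hitting time $H(A_n\setminus\{x\})/2^{\gamma n}$ is, uniformly in $x\in A_n$, asymptotically exponentially distributed with mean $1/\rho$: for all $t\ge0$ $$\lim_{n\to\infty}\max_{x\in A_n}\Big|\mathbb P_x\big[H(A_n\setminus\{x\})>t\,2^{\gamma n}\big]-e^{-\rho t}\Big|=0 .$$ -/

import Mathlib

open MeasureTheory ProbabilityTheory Filter Topology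
open scoped ENNReal

/-- The vertex set `{-1, 1}^n` of the `n`-dimensional hypercube (`ℤˣ = {1, -1}`). -/
abbrev Cube (n : ℕ) : Type := Fin n → ℤˣ

/-- The graph of the `n`-dimensional hypercube: two vertices are joined by an edge iff they differ
in exactly one coordinate. -/
def hypercube (n : ℕ) : SimpleGraph (Cube n) where
  Adj x y := hammingDist x y = 1
  symm := ⟨fun x y h => by rw [hammingDist_comm]; exact h⟩
  loopless := ⟨fun x h => by simp at h⟩

instance (n : ℕ) : DecidableRel (hypercube n).Adj :=
  fun x y => inferInstanceAs (Decidable (hammingDist x y = 1))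

open scoped Classical in
/-- Under the probability measure `P`, the process `Y 0, Y 1, Y 2, …` is the discrete-time simple
random walk on the graph `G` started at `x`: it starts at `x`, and given its past it jumps to each
of the neighbours of its present position with the same probability `1 / degree`. -/
structure IsSimpleRandomWalk {V Ω : Type*} [MeasurableSpace Ω] (G : SimpleGraph V)
    [G.LocallyFinite] (P : Measure Ω) (Y : ℕ → Ω → V) (x : V) : Prop where
  isProbabilityMeasure : IsProbabilityMeasure P
  measurable : ∀ (k : ℕ) (v : V), MeasurableSet {ω | Y k ω = v}
  start : ∀ᵐ ω ∂P, Y 0 ω = x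
  step : ∀ (k : ℕ) (y : ℕ → V),
    P {ω | ∀ i ≤ k + 1, Y i ω = y i} =
      P {ω | ∀ i ≤ k, Y i ω = y i} *
        (if G.Adj (y k) (y (k + 1)) then (G.degree (y k) : ℝ≥0∞)⁻¹ else 0)

/-- The hitting time `H(S) = inf {i ≥ 0 : Y i ∈ S}`, equal to `⊤ = ∞` if `S` is never visited. -/
noncomputable def hittingTime {V Ω : Type*} (Y : ℕ → Ω → V) (S : Set V) (ω : Ω) : ℕ∞ :=
  hittingAfter Y S 0 ω

/-- The number `exp (-a h)` for a time `h` in `{0, 1, 2, …, ∞}`, with `exp (-a ∞) = 0`. -/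
noncomputable def expNeg (a : ℝ) (h : ℕ∞) : ℝ :=
  if h = ⊤ then 0 else Real.exp (-(a * (h.toNat : ℝ)))

/-- The rate function `I` of the symmetric Bernoulli distribution on `{0, 1}`
(here `0 log 0 = 0`). -/
noncomputable def bernoulliRate (u : ℝ) : ℝ :=
  u * Real.log u + (1 - u) * Real.log (1 - u) + Real.log 2

/-- Flipping the coordinate `c` of a vertex of the hypercube. -/
def flipAt {n : ℕ} (x : Cube n) (c : Fin n) : Cube n := Function.update x c (-(x c))

theorem hypercube_adj_iff {n : ℕ} (x y : Cube n) :
    (hypercube n).Adj x y ↔ ∃ c, flipAt x c = y := by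
  change hammingDist x y = 1 ↔ _
  unfold hammingDist
  rw [Finset.card_eq_one]
  constructor
  · rintro ⟨c, hc⟩
    refine ⟨c, funext fun i => ?_⟩
    have h := Finset.ext_iff.1 hc i
    simp only [Finset.mem_filter, Finset.mem_univ, true_and, Finset.mem_singleton] at h
    by_cases hi : i = c
    · subst hi
      have h1 : x i ≠ y i := h.2 rfl
      simp only [flipAt, Function.update_self]
      rcases Int.units_eq_one_or (x i) with h2 | h2 <;>
        rcases Int.units_eq_one_or (y i) with h3 | h3 <;> simp_all
    · simp only [flipAt, Function.update_of_ne hi]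
      by_contra h2
      exact hi (h.1 h2)
  · rintro ⟨c, rfl⟩
    refine ⟨c, Finset.ext fun i => ?_⟩
    rw [Finset.mem_filter, Finset.mem_singleton]
    by_cases hi : i = c
    · subst hi
      have h : flipAt x i i = -(x i) := by simp [flipAt]
      have h1 : ∀ u : ℤˣ, u ≠ -u := by decide
      rw [h]
      exact ⟨fun _ => rfl, fun _ => ⟨Finset.mem_univ _, h1 _⟩⟩
    · have h : flipAt x c i = x i := by simp [flipAt, hi]
      rw [h]
      exact ⟨fun h1 => absurd rfl h1.2, fun h1 => absurd h1 hi⟩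

theorem flipAt_injective {n : ℕ} (x : Cube n) : Function.Injective (flipAt x) := by
  intro c d h
  by_contra hcd
  have h1 := congrFun h c
  simp only [flipAt, Function.update_self, Function.update_of_ne hcd] at h1
  rcases Int.units_eq_one_or (x c) with h2 | h2 <;> rw [h2] at h1 <;> revert h1 <;> decide

theorem hypercube_degree {n : ℕ} (x : Cube n) : (hypercube n).degree x = n := by
  have h : (hypercube n).neighborFinset x = Finset.univ.image (flipAt x) := by
    ext y
    simp [hypercube_adj_iff]
  rw [← SimpleGraph.card_neighborFinset_eq_degree, h,
    Finset.card_image_of_injective _ (flipAt_injective x)]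
  simp

/-- The trajectory obtained from `x` by flipping the coordinates `ω 0, ω 1, …` one after another. -/
def flipPath {n : ℕ} (x : Cube n) (ω : ℕ → Fin n) : ℕ → Cube n
  | 0 => x
  | k + 1 => flipAt (flipPath x ω k) (ω k)

theorem flipPath_cylinder {n : ℕ} (x : Cube n) (y : ℕ → Cube n) (a₀ : Fin n) (k : ℕ) :
    {ω : ℕ → Fin n | ∀ i ≤ k, flipPath x ω i = y i} = ∅ ∨
      ∃ a : ℕ → Fin n, {ω : ℕ → Fin n | ∀ i ≤ k, flipPath x ω i = y i} =
        Set.pi (Finset.range k : Set ℕ) (fun i => {a i}) := by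
  induction k with
  | zero =>
    by_cases h : x = y 0
    · right
      exact ⟨fun _ => a₀, by ext ω; simp [flipPath, h]⟩
    · left
      ext ω
      simp [flipPath, h]
  | succ k ih =>
    have key : {ω : ℕ → Fin n | ∀ i ≤ k + 1, flipPath x ω i = y i} =
        {ω : ℕ → Fin n | ∀ i ≤ k, flipPath x ω i = y i} ∩
          {ω | flipAt (y k) (ω k) = y (k + 1)} := by
      ext ω
      simp only [Set.mem_ofPred_eq, Set.mem_inter_iff]
      constructor
      · intro h
        refine ⟨fun i hi => h i (by omega), ?_⟩
        rw [← h k (by omega), ← h (k + 1) le_rfl]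
        rfl
      · rintro ⟨h1, h2⟩ i hi
        rcases Nat.lt_or_ge k i with h | h
        · obtain rfl : i = k + 1 := by omega
          rw [← h2, ← h1 k le_rfl]
          rfl
        · exact h1 i h
    rcases ih with h | ⟨a, h⟩
    · left
      rw [key, h, Set.empty_inter]
    · by_cases hadj : ∃ c, flipAt (y k) c = y (k + 1)
      · obtain ⟨c, hc⟩ := hadj
        right
        refine ⟨Function.update a k c, ?_⟩
        rw [key, h]
        ext ω
        simp only [Set.mem_inter_iff, Set.mem_pi, Finset.coe_range, Set.mem_Iio,
          Set.mem_singleton_iff, Set.mem_ofPred_eq]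
        constructor
        · rintro ⟨h1, h2⟩ i hi
          rcases Nat.lt_or_ge i k with h3 | h3
          · rw [Function.update_of_ne h3.ne, h1 i h3]
          · obtain rfl : i = k := by omega
            rw [Function.update_self]
            exact flipAt_injective _ (h2.trans hc.symm)
        · intro h1
          refine ⟨fun i hi => ?_, ?_⟩
          · rw [h1 i (by omega), Function.update_of_ne hi.ne]
          · rw [h1 k (by omega), Function.update_self, hc]
      · left
        rw [key]
        ext ω
        simp only [Set.mem_inter_iff, Set.mem_ofPred_eq, Set.mem_empty_iff_false, iff_false]
        exact fun h1 => hadj ⟨ω k, h1.2⟩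

/-- For `n ≥ 1` the simple random walk on the `n`-dimensional hypercube exists: flip a uniformly
chosen coordinate at each step, independently of the past. -/
theorem exists_isSimpleRandomWalk_hypercube (n : ℕ) (hn : 1 ≤ n) :
    ∃ (P : Measure (ℕ → Fin n)) (Y : Cube n → ℕ → (ℕ → Fin n) → Cube n),
      ∀ x, IsSimpleRandomWalk (hypercube n) P (Y x) x := by
  have : Nonempty (Fin n) := ⟨⟨0, hn⟩⟩
  have hμ : ∀ c : Fin n, uniformOn (Set.univ : Set (Fin n)) {c} = (n : ℝ≥0∞)⁻¹ := by
    intro c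
    rw [uniformOn_univ]
    simp
  have hcyl : ∀ (k : ℕ) (a : ℕ → Fin n),
      Measure.infinitePi (fun _ : ℕ => uniformOn (Set.univ : Set (Fin n)))
        (Set.pi (Finset.range k : Set ℕ) (fun i => {a i})) = (n : ℝ≥0∞)⁻¹ ^ k := by
    intro k a
    rw [Measure.infinitePi_pi _ (fun i _ => measurableSet_singleton _)]
    simp [hμ]
  refine ⟨Measure.infinitePi (fun _ : ℕ => uniformOn (Set.univ : Set (Fin n))),
    fun x k ω => flipPath x ω k, fun x => ⟨inferInstance, fun k => ?_, ?_, fun k y => ?_⟩⟩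
  · induction k with
    | zero => intro v; exact MeasurableSet.const (x = v)
    | succ k ih =>
      intro v
      have h : {ω : ℕ → Fin n | flipPath x ω (k + 1) = v} =
          ⋃ (u : Cube n) (c : Fin n) (_ : flipAt u c = v),
            {ω | flipPath x ω k = u} ∩ {ω | ω k = c} := by
        ext ω
        simp only [Set.mem_ofPred_eq, Set.mem_iUnion, Set.mem_inter_iff, exists_prop]
        constructor
        · exact fun h1 => ⟨_, _, h1, rfl, rfl⟩
        · rintro ⟨u, c, h1, rfl, rfl⟩
          exact h1
      rw [h]
      refine MeasurableSet.iUnion fun u => MeasurableSet.iUnion fun c =>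
        MeasurableSet.iUnion fun _ => (ih u).inter ?_
      have hk : Measurable (fun ω : ℕ → Fin n => ω k) := measurable_pi_apply k
      exact hk (measurableSet_singleton c)
  · exact Filter.Eventually.of_forall fun ω => rfl
  · have a₀ : Fin n := Classical.arbitrary _
    have hstep : ∀ ω : ℕ → Fin n, (∀ i ≤ k + 1, flipPath x ω i = y i) →
        (hypercube n).Adj (y k) (y (k + 1)) := by
      intro ω h
      rw [hypercube_adj_iff]
      refine ⟨ω k, ?_⟩
      rw [← h k (by omega), ← h (k + 1) le_rfl]
      rfl
    by_cases hadj : (hypercube n).Adj (y k) (y (k + 1))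
    · rw [if_pos hadj, hypercube_degree]
      rcases flipPath_cylinder x y a₀ k with h | ⟨a, h⟩
      · have h' : {ω : ℕ → Fin n | ∀ i ≤ k + 1, flipPath x ω i = y i} = ∅ := by
          refine Set.subset_eq_empty (fun ω hω => ?_) h
          exact fun i hi => hω i (by omega)
        simp only [h, h', measure_empty, zero_mul]
      · rcases flipPath_cylinder x y a₀ (k + 1) with h' | ⟨b, h'⟩
        · exfalso
          obtain ⟨c, hc⟩ := (hypercube_adj_iff _ _).1 hadj
          have h1 : Function.update a k c ∈
              {ω : ℕ → Fin n | ∀ i ≤ k, flipPath x ω i = y i} := by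
            rw [h]
            intro i hi
            have h2 : i < k := by simpa using hi
            simp [Function.update_of_ne h2.ne]
          have h2 : Function.update a k c ∈
              {ω : ℕ → Fin n | ∀ i ≤ k + 1, flipPath x ω i = y i} := by
            intro i hi
            rcases Nat.lt_or_ge k i with h3 | h3
            · obtain rfl : i = k + 1 := by omega
              rw [← hc, ← h1 k le_rfl]
              simp [flipPath]
            · exact h1 i h3
          rw [h'] at h2
          exact h2
        · rw [h, h', hcyl, hcyl, pow_succ]
    · rw [if_neg hadj, mul_zero]
      have h' : {ω : ℕ → Fin n | ∀ i ≤ k + 1, flipPath x ω i = y i} = ∅ :=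
        Set.eq_empty_of_forall_notMem fun ω hω => hadj (hstep ω hω)
      rw [h', measure_empty]

/-! Put N = 2^(γn), l = exp(-s/N) with s > 0, and let g be the Green function of the walk killed
with probability 1 - l per step. For fixed x in A, the potential f(v) = ∑ g(v, y), summed over y in
A \ {x}, satisfies f(u) = l · (mean of f over the neighbours of u) off A \ {x}. Optional stopping
gives f(x) = E_x[l^H f(Y_H)]. If f(x) ≈ M while f ≈ 1 + M on A \ {x}, then E_x[l^H] ≈ M / (1 + M).
With M = ρ/s this is ρ/(s + ρ).

The extra 1 is the diagonal value g(v, v) → 1: early returns to the start have total probability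
O(1/n). The value of M comes from replacing g(v, y), for distinct points of A, by its uniform
counterpart 1/(2^n (1 - l)), since |A| / (2^n (1 - l)) → ρ/s. There are about ρ 2^((1-γ)n) summands,
so each replacement must cost o(2^(-(1-γ)n)). Times k ≥ n² are handled by the spectral gap 2/n,
apart from a parity oscillation whose alternating series is harmless. For k < n², conservation of
mass bounds the transition probability at distance d by 1 / C(n, d), and C(n, d)² ≥ exp(n h(d/n))
with h the binary entropy. At distance ≥ ηn this is small enough when h(η) > 2(1 - γ) log 2, that
is, when I(η) < (2γ - 1) log 2: exactly η > ω(γ) in the range below 1/2.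

The estimates are carried by `exists_abs_distGreen_sub_le` and
`exists_abs_distGreen_zero_sub_one_le`, the stopping argument by `abs_sub_mul_integral_expNeg_le`.
For the tails, exp(-H/N) lies in [0, 1] and its k-th moment is the transform at s = k, so the method
of moments gives convergence in law to U^(1/ρ), U uniform. Testing along worst starting points makes
this uniform in x. -/

/-! ### Transition probabilities of the walk as functions of the distance -/

/-- The `k`-step transition probability of the simple random walk on the `n`-dimensional hypercube
between two vertices at Hamming distance `d`. -/
noncomputable def distProb (n : ℕ) : ℕ → ℕ → ℝ
  | 0, d => if d = 0 then 1 else 0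
  | k + 1, d => d / n * distProb n k (d - 1) + (n - d) / n * distProb n k (d + 1)

theorem distProb_nonneg {n : ℕ} (k : ℕ) {d : ℕ} (hd : d ≤ n) : 0 ≤ distProb n k d := by
  induction k generalizing d with
  | zero => simp only [distProb]; split_ifs <;> norm_num
  | succ k ih =>
    simp only [distProb]
    have h0 : 0 ≤ distProb n k (d - 1) := ih (by omega)
    rcases hd.eq_or_lt with rfl | hlt
    · simp only [sub_self, zero_div, zero_mul, add_zero]
      positivity
    · have h1 : 0 ≤ distProb n k (d + 1) := ih (by omega)
      have h2 : (0 : ℝ) ≤ n - d := sub_nonneg.2 (by exact_mod_cast hd)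
      positivity

/-- Both sides at time k + 1 compare with the value at distance d + 1 and time k: by induction it
dominates both terms of the average at d + 2 and is dominated by both terms at d. Terms that would
leave [0, n] have weight zero. The step is 2 because the walk is periodic. -/
theorem distProb_add_two_le {n : ℕ} (k : ℕ) {d : ℕ} (hd : d + 2 ≤ n) :
    distProb n k (d + 2) ≤ distProb n k d := by
  have hn : (0 : ℝ) < n := by exact_mod_cast (by omega : 0 < n)
  induction k generalizing d with
  | zero =>
    simp only [distProb, Nat.add_eq_zero_iff, OfNat.ofNat_ne_zero, and_false, if_false]
    split_ifs <;> norm_num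
  | succ k ih =>
    simp only [distProb]
    have e1 : d + 2 - 1 = d + 1 := by omega
    rw [e1]
    have h1 : (d : ℝ) * distProb n k (d + 1) ≤ d * distProb n k (d - 1) := by
      rcases Nat.eq_zero_or_pos d with rfl | hpos
      · simp
      · have := ih (d := d - 1) (by omega)
        rw [show d - 1 + 2 = d + 1 by omega] at this
        gcongr
    have h2 : ((n : ℝ) - (d + 2 : ℕ)) * distProb n k (d + 2 + 1) ≤
        ((n : ℝ) - (d + 2 : ℕ)) * distProb n k (d + 1) := by
      rcases hd.eq_or_lt with h | hlt
      · rw [← h]; simp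
      · have := ih (d := d + 1) (by omega)
        have h3 : (0 : ℝ) ≤ n - (d + 2 : ℕ) := sub_nonneg.2 (by exact_mod_cast hd)
        exact mul_le_mul_of_nonneg_left this h3
    rw [div_mul_eq_mul_div, div_mul_eq_mul_div, div_mul_eq_mul_div, div_mul_eq_mul_div,
      ← add_div, ← add_div]
    refine div_le_div_of_nonneg_right ?_ hn.le
    have h3 := distProb_nonneg k (show d + 1 ≤ n by omega)
    push_cast at h2 ⊢
    linarith

/-- Conservation of mass: C(n, d) vertices lie at distance d. In the induction step, absorption
identities turn the weights into binomial coefficients of n - 1, and Pascal's rule reassembles them.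
-/
theorem sum_choose_mul_distProb {n : ℕ} (hn : 1 ≤ n) (k : ℕ) :
    ∑ d ∈ Finset.range (n + 1), (n.choose d : ℝ) * distProb n k d = 1 := by
  obtain ⟨m, rfl⟩ : ∃ m, n = m + 1 := ⟨n - 1, by omega⟩
  have hm : ((m + 1 : ℕ) : ℝ) ≠ 0 := by positivity
  induction k with
  | zero => simp [distProb]
  | succ k ih =>
    simp only [distProb, mul_add, Finset.sum_add_distrib]
    have e1 : ∑ d ∈ Finset.range (m + 1 + 1), ((m + 1).choose d : ℝ) *
        (d / (m + 1 : ℕ) * distProb (m + 1) k (d - 1)) =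
        ∑ d ∈ Finset.range (m + 1), (m.choose d : ℝ) * distProb (m + 1) k d := by
      rw [Finset.sum_range_succ']
      simp only [Nat.cast_zero, zero_div, zero_mul, mul_zero, add_zero, Nat.add_sub_cancel]
      refine Finset.sum_congr rfl fun d _ => ?_
      have := Nat.add_one_mul_choose_eq m d
      have h : ((m + 1 : ℕ) : ℝ) * m.choose d = (m + 1).choose (d + 1) * (d + 1 : ℕ) := by
        exact_mod_cast this
      rw [← mul_assoc, ← mul_div_assoc, ← h]
      field_simp
    have e2 : ∑ d ∈ Finset.range (m + 1 + 1), ((m + 1).choose d : ℝ) *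
        (((m + 1 : ℕ) - d) / (m + 1 : ℕ) * distProb (m + 1) k (d + 1)) =
        ∑ d ∈ Finset.range (m + 1), (m.choose d : ℝ) * distProb (m + 1) k (d + 1) := by
      rw [Finset.sum_range_succ]
      simp only [sub_self, zero_div, zero_mul, mul_zero, add_zero]
      refine Finset.sum_congr rfl fun d hd => ?_
      have hd' : d ≤ m := by simpa [Nat.lt_succ_iff] using hd
      have := Nat.choose_mul_succ_eq m d
      have h : (m.choose d : ℝ) * (m + 1 : ℕ) = (m + 1).choose d * (((m + 1 : ℕ) : ℝ) - d) := by
        rw [← Nat.cast_sub (by omega)]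
        exact_mod_cast this
      rw [← mul_assoc, ← mul_div_assoc, ← h]
      field_simp
    rw [e1, e2]
    rw [Finset.sum_range_succ'] at ih
    simp only [Nat.choose_succ_succ, Nat.cast_add, add_mul, Finset.sum_add_distrib] at ih
    rw [Finset.sum_range_succ (fun d => (m.choose (d + 1) : ℝ) * _)] at ih
    rw [Finset.sum_range_succ' (fun d => (m.choose d : ℝ) * _)]
    simp at ih ⊢
    linarith

theorem choose_mul_distProb_le_one {n : ℕ} (hn : 1 ≤ n) (k : ℕ) {d : ℕ} (hd : d ≤ n) :
    (n.choose d : ℝ) * distProb n k d ≤ 1 := by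
  rw [← sum_choose_mul_distProb hn k]
  refine Finset.single_le_sum (f := fun d => (n.choose d : ℝ) * distProb n k d)
    (fun e he => ?_) (Finset.mem_range.2 (by omega))
  exact mul_nonneg (by positivity) (distProb_nonneg k (by simpa [Nat.lt_succ_iff] using he))

theorem distProb_le_one {n : ℕ} (hn : 1 ≤ n) (k : ℕ) {d : ℕ} (hd : d ≤ n) :
    distProb n k d ≤ 1 := by
  refine le_trans ?_ (choose_mul_distProb_le_one hn k hd)
  refine le_mul_of_one_le_left (distProb_nonneg k hd) ?_
  exact_mod_cast Nat.choose_pos hd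

theorem hammingDist_le_dim {n : ℕ} (x y : Cube n) : hammingDist x y ≤ n := by
  simpa using hammingDist_le_card_fintype (x := x) (y := y)

theorem hammingDist_flipAt {n : ℕ} (x y : Cube n) (c : Fin n) :
    hammingDist (flipAt x c) y =
      if x c ≠ y c then hammingDist x y - 1 else hammingDist x y + 1 := by
  have hu : ∀ u v : ℤˣ, -u ≠ v ↔ u = v := by decide
  have h : ∀ z : Cube n, hammingDist z y =
      (∑ i ∈ Finset.univ.erase c, if z i ≠ y i then 1 else 0) + if z c ≠ y c then 1 else 0 := by
    intro z
    rw [Finset.sum_erase_add _ _ (Finset.mem_univ c), hammingDist, Finset.card_filter]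
  rw [h x, h (flipAt x c)]
  have h1 : ∀ i ∈ Finset.univ.erase c, (if flipAt x c i ≠ y i then 1 else 0) =
      if x i ≠ y i then 1 else 0 := by
    intro i hi
    simp [flipAt, Function.update_of_ne (Finset.ne_of_mem_erase hi)]
  rw [Finset.sum_congr rfl h1]
  simp only [flipAt, Function.update_self, hu]
  split_ifs <;> simp_all

theorem sum_hammingDist_flipAt {n : ℕ} (f : ℕ → ℝ) (x y : Cube n) :
    ∑ c, f (hammingDist (flipAt x c) y) =
      hammingDist x y * f (hammingDist x y - 1) +
        (n - hammingDist x y) * f (hammingDist x y + 1) := by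
  simp only [hammingDist_flipAt, apply_ite f]
  rw [Finset.sum_ite]
  simp only [Finset.sum_const, nsmul_eq_mul]
  have h1 : (Finset.univ.filter fun c => x c ≠ y c).card = hammingDist x y := rfl
  have h2 : (Finset.univ.filter fun c => ¬ x c ≠ y c).card + hammingDist x y = n := by
    rw [← h1, add_comm, Finset.card_filter_add_card_filter_not]
    simp
  have h3 : ((Finset.univ.filter fun c => ¬ x c ≠ y c).card : ℝ) = n - hammingDist x y := by
    rw [eq_sub_iff_add_eq]
    exact_mod_cast h2
  rw [h1, h3]

theorem distProb_succ_hammingDist {n : ℕ} (k : ℕ) (x y : Cube n) :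
    distProb n (k + 1) (hammingDist x y) =
      (∑ c, distProb n k (hammingDist (flipAt x c) y)) / n := by
  rw [sum_hammingDist_flipAt, distProb]
  ring

/-- Fourier inversion on the cube: the character of S is an eigenfunction of the walk with
eigenvalue 1 - 2|S|/n, and at time 0 the sum factors as ∏ (1 + x_i y_i), which is 2^n times the
indicator of x = y. -/
theorem distProb_hammingDist_eq_sum {n : ℕ} (hn : 1 ≤ n) (k : ℕ) (x y : Cube n) :
    distProb n k (hammingDist x y) = (∑ S : Finset (Fin n),
      (∏ i ∈ S, (((x i * y i : ℤˣ) : ℤ) : ℝ)) * (1 - 2 * S.card / n) ^ k) / 2 ^ n := by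
  have hn' : (n : ℝ) ≠ 0 := by positivity
  induction k generalizing x with
  | zero =>
    simp only [pow_zero, mul_one, distProb, hammingDist_eq_zero]
    have h := Finset.prod_one_add (f := fun i => (((x i * y i : ℤˣ) : ℤ) : ℝ)) Finset.univ
    rw [Finset.powerset_univ] at h
    rw [← h]
    have hu : ∀ u v : ℤˣ, u ≠ v → u * v = -1 := by decide
    split_ifs with hxy
    · subst hxy
      simp [Int.units_mul_self, one_add_one_eq_two]
    · obtain ⟨i, hi⟩ := Function.ne_iff.1 hxy
      rw [Finset.prod_eq_zero (Finset.mem_univ i), zero_div]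
      rw [hu _ _ hi]
      simp
  | succ k ih =>
    rw [distProb_succ_hammingDist]
    simp only [ih]
    rw [← Finset.sum_div, Finset.sum_comm, div_right_comm, Finset.sum_div]
    congr 1
    refine Finset.sum_congr rfl fun S _ => ?_
    rw [← Finset.sum_mul]
    have h1 : ∀ c, (∏ i ∈ S, (((flipAt x c i * y i : ℤˣ) : ℤ) : ℝ)) =
        (if c ∈ S then -1 else 1) * ∏ i ∈ S, (((x i * y i : ℤˣ) : ℤ) : ℝ) := by
      intro c
      have h2 : ∀ i, (((flipAt x c i * y i : ℤˣ) : ℤ) : ℝ) =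
          (if c = i then -1 else 1) * (((x i * y i : ℤˣ) : ℤ) : ℝ) := by
        intro i
        by_cases h : c = i
        · subst h; simp [flipAt]
        · simp [flipAt, Function.update_of_ne (Ne.symm h), h]
      simp only [h2]
      rw [Finset.prod_mul_distrib, Finset.prod_ite_eq S c]
    simp only [h1]
    rw [← Finset.sum_mul]
    have h3 : ∑ c : Fin n, (if c ∈ S then (-1 : ℝ) else 1) = n - 2 * S.card := by
      have h4 : ∀ c : Fin n, (if c ∈ S then (-1 : ℝ) else 1) = 1 - 2 * if c ∈ S then 1 else 0 := by
        intro c; split_ifs <;> norm_num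
      simp only [h4, Finset.sum_sub_distrib, ← Finset.mul_sum]
      simp
    rw [h3, pow_succ]
    field_simp

/-- The characters of the empty and the full set have eigenvalues 1 and -1 and give the main term, σ
being the parity sign ∏ x_i y_i. All other eigenvalues are at most 1 - 2/n in modulus; there are
fewer than 2^n of them, which the normalisation absorbs. -/
theorem exists_abs_distProb_sub_le {n : ℕ} (hn : 2 ≤ n) (x y : Cube n) :
    ∃ σ : ℝ, |σ| = 1 ∧ ∀ k, |distProb n k (hammingDist x y) - (1 + σ * (-1) ^ k) / 2 ^ n| ≤
      (1 - 2 / n) ^ k := by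
  classical
  have hn0 : (0 : ℝ) < n := by positivity
  have hn2 : (2 : ℝ) ≤ n := by exact_mod_cast hn
  have hprod : ∀ S : Finset (Fin n), |∏ i ∈ S, (((x i * y i : ℤˣ) : ℤ) : ℝ)| = 1 := by
    intro S
    rw [Finset.abs_prod]
    refine Finset.prod_eq_one fun i _ => ?_
    rcases Int.units_eq_one_or (x i * y i) with h | h <;> rw [h] <;> simp
  refine ⟨∏ i, (((x i * y i : ℤˣ) : ℤ) : ℝ), hprod _, fun k => ?_⟩
  rw [distProb_hammingDist_eq_sum (by omega), ← sub_div, abs_div, abs_of_pos (a := (2 : ℝ) ^ n)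
    (by positivity), div_le_iff₀ (by positivity)]
  have huniv : (Finset.univ : Finset (Fin n)) ≠ ∅ :=
    Finset.nonempty_iff_ne_empty.1 ⟨⟨0, by omega⟩, Finset.mem_univ _⟩
  rw [← Finset.add_sum_erase _ _ (Finset.mem_univ (∅ : Finset (Fin n))),
    ← Finset.add_sum_erase _ _
      (Finset.mem_erase.2 ⟨huniv, Finset.mem_univ (Finset.univ : Finset (Fin n))⟩)]
  have e1 : (1 : ℝ) - 2 * (Finset.univ : Finset (Fin n)).card / n = -1 := by
    simp only [Finset.card_univ, Fintype.card_fin]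
    field_simp
    norm_num
  rw [e1]
  simp only [Finset.prod_empty, Finset.card_empty, Nat.cast_zero, mul_zero, zero_div, sub_zero,
    one_pow, mul_one, ← add_assoc, add_sub_cancel_left]
  refine (Finset.abs_sum_le_sum_abs _ _).trans ?_
  have hcard : (((Finset.univ.erase (∅ : Finset (Fin n))).erase Finset.univ).card : ℝ) ≤ 2 ^ n := by
    have : ((Finset.univ.erase (∅ : Finset (Fin n))).erase Finset.univ).card ≤
        (Finset.univ : Finset (Finset (Fin n))).card :=
      Finset.card_le_card ((Finset.erase_subset _ _).trans (Finset.erase_subset _ _))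
    rw [Finset.card_univ, Fintype.card_finset, Fintype.card_fin] at this
    exact_mod_cast this
  have h0 : 0 ≤ (1 - 2 / (n : ℝ)) := sub_nonneg.2 ((div_le_one hn0).2 hn2)
  refine (Finset.sum_le_card_nsmul _ _ ((1 - 2 / (n : ℝ)) ^ k) fun S hS => ?_).trans ?_
  · rw [abs_mul, hprod, one_mul, abs_pow]
    refine pow_le_pow_left₀ (abs_nonneg _) ?_ k
    simp only [Finset.mem_erase, Finset.mem_univ, and_true] at hS
    have hS1 : 1 ≤ S.card := Finset.card_pos.2 (Finset.nonempty_iff_ne_empty.2 hS.2)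
    have hS2 : S.card + 1 ≤ n := by
      have := Finset.card_lt_card (Finset.ssubset_univ_iff.2 hS.1)
      simpa using this
    have hS1' : (1 : ℝ) ≤ S.card := by exact_mod_cast hS1
    have hS2' : (S.card : ℝ) + 1 ≤ n := by exact_mod_cast hS2
    rw [abs_le]
    constructor
    · rw [neg_le_sub_iff_le_add, ← sub_nonneg]
      have : 1 - 2 / (n : ℝ) + 1 - 2 * S.card / n = 2 * (n - (S.card + 1)) / n := by
        field_simp; ring
      rw [show (1 + (1 - 2 / (n : ℝ)) - 2 * S.card / n) = 2 * (n - (S.card + 1)) / n by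
        rw [← this]; ring]
      exact div_nonneg (by linarith) hn0.le
    · gcongr
      linarith
  · rw [nsmul_eq_mul, mul_comm]
    gcongr

/-! ### Binomial bounds and return probabilities -/

theorem div_pow_le_choose {n d : ℕ} (hd : d ≤ n) : ((n : ℝ) / d) ^ d ≤ n.choose d := by
  induction d generalizing n with
  | zero => simp
  | succ d ih =>
    obtain ⟨m, rfl⟩ : ∃ m, n = m + 1 := ⟨n - 1, by omega⟩
    have hdm : d ≤ m := by omega
    have h := Nat.add_one_mul_choose_eq m d
    have h' : ((m + 1).choose (d + 1) : ℝ) = ((m + 1 : ℕ) / (d + 1 : ℕ)) * m.choose d := by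
      rw [div_mul_eq_mul_div, eq_div_iff (by positivity)]
      exact_mod_cast h.symm
    rw [h', pow_succ']
    gcongr
    refine le_trans ?_ (ih hdm)
    rcases Nat.eq_zero_or_pos d with rfl | hpos
    · simp
    · refine pow_le_pow_left₀ (by positivity) ?_ d
      have hd0 : (0 : ℝ) < d := by exact_mod_cast hpos
      have : (d : ℝ) ≤ m := by exact_mod_cast hdm
      rw [div_le_div_iff₀ (by positivity) hd0]
      push_cast
      nlinarith

/-- exp(n h(d/n)) = (n/d)^d (n/(n-d))^(n-d), and each factor is at most C(n, d) = C(n, n-d). The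
square costs half the exponent, which the factor 2 in the definition of ω(γ) allows. -/
theorem exp_binEntropy_le_choose_sq {n d : ℕ} (hd0 : 0 < d) (hd : d < n) :
    Real.exp (n * Real.binEntropy (d / n)) ≤ (n.choose d : ℝ) ^ 2 := by
  have hd0' : (0 : ℝ) < d := by exact_mod_cast hd0
  have hdn : (d : ℝ) < n := by exact_mod_cast hd
  have hn0 : (0 : ℝ) < n := hd0'.trans hdn
  have hnd : (0 : ℝ) < n - d := sub_pos.2 hdn
  have h1 := div_pow_le_choose hd.le
  have h2 := div_pow_le_choose (Nat.sub_le n d)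
  rw [Nat.choose_symm hd.le, Nat.cast_sub hd.le] at h2
  have h3 : Real.exp (n * Real.binEntropy (d / n)) =
      ((n : ℝ) / d) ^ d * ((n : ℝ) / (n - d)) ^ (n - d) := by
    rw [Real.binEntropy, ← Real.exp_log (x := ((n : ℝ) / d) ^ d * ((n : ℝ) / (n - d)) ^ (n - d))
      (by positivity), Real.log_mul (by positivity) (by positivity), Real.log_pow, Real.log_pow,
      Nat.cast_sub hd.le, inv_div, show (1 - (d : ℝ) / n) = (n - d) / n by field_simp, inv_div]
    congr 1
    field_simp
  rw [h3, sq]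
  gcongr

theorem distProb_le_of_le_three {n : ℕ} (hn : 3 ≤ n) (k : ℕ) {d : ℕ} (hd : d ≤ 3) :
    distProb n k d ≤ 27 / (n : ℝ) ^ d := by
  have hn0 : (0 : ℝ) < n := by positivity
  have h1 := choose_mul_distProb_le_one (n := n) (by omega) k (d := d) (by omega)
  have h2 := div_pow_le_choose (n := n) (d := d) (by omega)
  have h3 := mul_le_mul_of_nonneg_right h2 (distProb_nonneg (n := n) k (d := d) (by omega))
  rw [le_div_iff₀ (by positivity)]
  have h4 : ((n : ℝ) / d) ^ d * distProb n k d ≤ 1 := h3.trans h1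
  -- The constant 27 = 3^3 is the largest of d^d for d ≤ 3.
  interval_cases d <;> simp [div_pow] at h4 ⊢ <;> ring_nf at h4 ⊢ <;> linarith

theorem distProb_zero_le {n : ℕ} (hn : 3 ≤ n) {k : ℕ} (hk : 1 ≤ k) :
    distProb n k 0 ≤ 27 / n := by
  obtain ⟨k, rfl⟩ : ∃ m, k = m + 1 := ⟨k - 1, by omega⟩
  have := distProb_le_of_le_three hn k (d := 1) (by norm_num)
  have hn0 : (n : ℝ) ≠ 0 := by positivity
  simpa [distProb, hn0] using this

/-- Unrolling the recursion from distance 0, every branch either reaches distance 3, where the bound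
is already of order n⁻³, or pays a factor 1/n for each move back. The cube is needed because the
bound is summed over n² times. -/
theorem distProb_zero_le_inv_cube {n : ℕ} (hn : 3 ≤ n) {k : ℕ} (hk : 5 ≤ k) :
    distProb n k 0 ≤ 1000 / (n : ℝ) ^ 3 := by
  have hn0 : (0 : ℝ) < n := by positivity
  have hn3 : (3 : ℝ) ≤ n := by exact_mod_cast hn
  have hsub : ∀ e : ℝ, 0 ≤ e → (n - e) / n ≤ 1 := fun e he => (div_le_one hn0).2 (by linarith)
  have b0 : ∀ k, 1 ≤ k → distProb n k 0 ≤ 27 / n := fun k hk => distProb_zero_le hn hk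
  have r0 : ∀ k, distProb n (k + 1) 0 = distProb n k 1 := by
    intro k; simp [distProb, hn0.ne']
  have r1 : ∀ k, distProb n (k + 1) 1 ≤ 1 / n * distProb n k 0 + distProb n k 2 := by
    intro k
    have := mul_le_mul_of_nonneg_right (hsub 1 zero_le_one)
      (distProb_nonneg (n := n) k (d := 2) (by omega))
    simp only [distProb, Nat.cast_one, Nat.sub_self] 
    linarith
  have r2 : ∀ k, distProb n (k + 1) 2 ≤ 2 / n * distProb n k 1 + distProb n k 3 := by
    intro k
    have := mul_le_mul_of_nonneg_right (hsub 2 zero_le_two)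
      (distProb_nonneg (n := n) k (d := 3) (by omega))
    simp only [distProb, Nat.cast_ofNat, Nat.add_one_sub_one]
    linarith
  have b1 : ∀ k, 1 ≤ k → distProb n (k + 1) 1 ≤ 54 / (n : ℝ) ^ 2 := by
    intro k hk
    refine (r1 k).trans ?_
    have h2 := distProb_le_of_le_three hn k (d := 2) (by norm_num)
    have h3 := mul_le_mul_of_nonneg_left (b0 k hk) (by positivity : 0 ≤ 1 / (n : ℝ))
    have : 1 / (n : ℝ) * (27 / n) + 27 / (n : ℝ) ^ 2 = 54 / (n : ℝ) ^ 2 := by field_simp; norm_num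
    linarith
  have b2 : ∀ k, 2 ≤ k → distProb n (k + 1) 2 ≤ 135 / (n : ℝ) ^ 3 := by
    intro k hk
    obtain ⟨k, rfl⟩ : ∃ m, k = m + 1 := ⟨k - 1, by omega⟩
    refine (r2 _).trans ?_
    have h2 := distProb_le_of_le_three hn (k + 1) (d := 3) (by norm_num)
    have h3 := mul_le_mul_of_nonneg_left (b1 k (by omega)) (by positivity : 0 ≤ 2 / (n : ℝ))
    have : 2 / (n : ℝ) * (54 / n ^ 2) + 27 / (n : ℝ) ^ 3 = 135 / (n : ℝ) ^ 3 := by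
      field_simp; norm_num
    linarith
  -- `r0` and `r1` use one time step each, and `b2` needs time at least 3.
  obtain ⟨k, rfl⟩ : ∃ m, k = m + 2 + 1 + 1 + 1 := ⟨k - 5, by omega⟩
  rw [r0]
  refine (r1 _).trans ?_
  have h2 := b2 (k + 2) (by omega)
  have h3 := mul_le_mul_of_nonneg_left (b1 (k + 1) (by omega)) (by positivity : 0 ≤ 1 / (n : ℝ))
  rw [← r0] at h3
  have h4 : 1 / (n : ℝ) * (54 / n ^ 2) + 135 / (n : ℝ) ^ 3 = 189 / (n : ℝ) ^ 3 := by
    field_simp; norm_num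
  have h5 : 189 / (n : ℝ) ^ 3 ≤ 1000 / (n : ℝ) ^ 3 := by gcongr; norm_num
  linarith

/-! ### The killed Green function and its uniform approximation -/

/-- The Green function of the simple random walk on the `n`-dimensional hypercube, killed with
probability `1 - l` at each step, between two vertices at Hamming distance `d`. -/
noncomputable def distGreen (n : ℕ) (l : ℝ) (d : ℕ) : ℝ := ∑' k, l ^ k * distProb n k d

section distGreen

variable {n : ℕ} {l : ℝ}

theorem summable_distGreen (hn : 1 ≤ n) (hl : 0 ≤ l) (hl' : l < 1) {d : ℕ} (hd : d ≤ n) :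
    Summable fun k => l ^ k * distProb n k d := by
  refine Summable.of_nonneg_of_le (fun k => mul_nonneg (by positivity) (distProb_nonneg k hd))
    (fun k => ?_) (summable_geometric_of_lt_one hl hl')
  exact mul_le_of_le_one_right (by positivity) (distProb_le_one hn k hd)

theorem distGreen_eq (hn : 1 ≤ n) (hl : 0 ≤ l) (hl' : l < 1) (x y : Cube n) :
    distGreen n l (hammingDist x y) = (if x = y then 1 else 0) +
      l * ((∑ c, distGreen n l (hammingDist (flipAt x c) y)) / n) := by
  have hs := fun z : Cube n => summable_distGreen hn hl hl' (hammingDist_le_dim z y)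
  rw [distGreen, (hs x).tsum_eq_zero_add]
  congr 1
  · simp [distProb, hammingDist_eq_zero]
  · simp only [distGreen]
    rw [← Summable.tsum_finsetSum fun c _ => hs _, ← tsum_div_const, ← tsum_mul_left]
    refine tsum_congr fun k => ?_
    rw [distProb_succ_hammingDist, pow_succ, ← Finset.mul_sum]
    ring

/-- The Green function summed over times `≥ T` is close to the one of the uniform distribution. -/
theorem abs_distGreen_sub_le (hn : 2 ≤ n) (hl : 0 ≤ l) (hl' : l < 1) (x y : Cube n) (T : ℕ) :
    |distGreen n l (hammingDist x y) - 1 / (2 ^ n * (1 - l)) -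
        ∑ k ∈ Finset.range T, l ^ k * distProb n k (hammingDist x y)| ≤
      (T + 1) / 2 ^ n + n * (1 - 2 / n) ^ T := by
  have hn0 : (0 : ℝ) < n := by positivity
  have hn2 : (2 : ℝ) ≤ n := by exact_mod_cast hn
  obtain ⟨σ, hσ, hk⟩ := exists_abs_distProb_sub_le hn x y
  set q : ℕ → ℝ := fun k => distProb n k (hammingDist x y) with hq
  have hsum : Summable fun k => l ^ k * q k :=
    summable_distGreen (by omega) hl hl' (hammingDist_le_dim x y)
  have hgeo := summable_geometric_of_lt_one hl hl'
  have hl2 : |(-l)| < 1 := by rwa [abs_neg, abs_of_nonneg hl]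
  have hgeo2 := summable_geometric_of_abs_lt_one hl2
  have h0 : 0 ≤ (1 - 2 / (n : ℝ)) := sub_nonneg.2 ((div_le_one hn0).2 hn2)
  have h1 : (1 - 2 / (n : ℝ)) < 1 := by linarith [div_pos two_pos hn0]
  have hgeo3 := summable_geometric_of_lt_one h0 h1
  have e1 : distGreen n l (hammingDist x y) - ∑ k ∈ Finset.range T, l ^ k * q k =
      ∑' k, l ^ (k + T) * q (k + T) := by
    rw [distGreen, ← hsum.sum_add_tsum_nat_add T]
    simp [hq]
  have e2 : ∑' k, l ^ (k + T) = 1 / (1 - l) - ∑ k ∈ Finset.range T, l ^ k := by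
    rw [eq_sub_iff_add_eq', hgeo.sum_add_tsum_nat_add T, tsum_geometric_of_lt_one hl hl', one_div]
  have e3 : ∑' k, (-l) ^ (k + T) = (-l) ^ T * (1 + l)⁻¹ := by
    simp only [pow_add]
    rw [tsum_mul_right, tsum_geometric_of_abs_lt_one hl2, sub_neg_eq_add, mul_comm]
  have e4 : ∑' k : ℕ, (1 - 2 / (n : ℝ)) ^ (k + T) = (1 - 2 / (n : ℝ)) ^ T * (n / 2) := by
    simp only [pow_add]
    rw [tsum_mul_right, tsum_geometric_of_lt_one h0 h1, mul_comm]
    congr 1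
    field_simp
    simp
  have s1 := (summable_nat_add_iff T).2 hsum
  have s2 := (summable_nat_add_iff T).2 hgeo
  have s3 := (summable_nat_add_iff T).2 hgeo2
  have s4 := (summable_nat_add_iff T).2 hgeo3
  -- The stationary part and the parity oscillation are removed, so that the remainder decays at the
  -- rate of the spectral gap.
  have e5 : ∑' k, l ^ (k + T) * q (k + T) - (∑' k, l ^ (k + T)) / 2 ^ n -
      σ * (∑' k, (-l) ^ (k + T)) / 2 ^ n =
      ∑' k, l ^ (k + T) * (q (k + T) - (1 + σ * (-1) ^ (k + T)) / 2 ^ n) := by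
    rw [← tsum_mul_left, ← tsum_div_const, ← tsum_div_const,
      ← s1.tsum_sub (s2.div_const _), ← (s1.sub (s2.div_const _)).tsum_sub
        ((s3.mul_left σ).div_const _)]
    refine tsum_congr fun k => ?_
    rw [neg_pow l]
    ring
  have b1 : |∑' k, l ^ (k + T) * (q (k + T) - (1 + σ * (-1) ^ (k + T)) / 2 ^ n)| ≤
      (1 - 2 / (n : ℝ)) ^ T * (n / 2) := by
    rw [← e4, ← Real.norm_eq_abs]
    refine tsum_of_norm_bounded s4.hasSum fun k => ?_
    rw [Real.norm_eq_abs, abs_mul, abs_of_nonneg (by positivity : 0 ≤ l ^ (k + T))]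
    exact (mul_le_of_le_one_left (abs_nonneg _) (pow_le_one₀ hl hl'.le)).trans (hk _)
  -- The oscillation does not decay in k, but its alternating geometric series is at most 1 in
  -- modulus. This is the 1 in T + 1; the T pays for the uniform mass at times before T.
  have b2 : |σ * (∑' k, (-l) ^ (k + T)) / 2 ^ n| ≤ 1 / 2 ^ n := by
    rw [e3, abs_div, abs_mul, hσ, one_mul, abs_mul, abs_pow, abs_neg, abs_of_nonneg hl,
      abs_of_pos (by positivity : 0 < (1 + l)⁻¹), abs_of_pos (by positivity : (0 : ℝ) < 2 ^ n)]
    gcongr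
    exact mul_le_one₀ (pow_le_one₀ hl hl'.le) (by positivity) (inv_le_one_of_one_le₀ (by linarith))
  have b3 : |(∑ k ∈ Finset.range T, l ^ k) / 2 ^ n| ≤ T / 2 ^ n := by
    rw [abs_div, abs_of_pos (by positivity : (0 : ℝ) < 2 ^ n),
      abs_of_nonneg (Finset.sum_nonneg fun k _ => by positivity)]
    gcongr
    refine (Finset.sum_le_card_nsmul _ _ 1 fun k _ => pow_le_one₀ hl hl'.le).trans ?_
    simp
  have b4 : 0 ≤ (1 - 2 / (n : ℝ)) ^ T * (n / 2) := by positivity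
  have e6 : distGreen n l (hammingDist x y) - 1 / (2 ^ n * (1 - l)) -
        ∑ k ∈ Finset.range T, l ^ k * q k =
      ∑' k, l ^ (k + T) * (q (k + T) - (1 + σ * (-1) ^ (k + T)) / 2 ^ n) +
        σ * (∑' k, (-l) ^ (k + T)) / 2 ^ n - (∑ k ∈ Finset.range T, l ^ k) / 2 ^ n := by
    have hl0 : 1 - l ≠ 0 := by linarith
    rw [← e5, ← e1, e2]
    field_simp
    ring
  rw [e6]
  rw [abs_le] at b1 b2 b3 ⊢
  rw [add_div]
  constructor <;> linarith

end distGreen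

/-! ### Exponential smallness at linear distance -/

theorem distProb_le_distProb_of_even {n k d j : ℕ} (h : d + 2 * j ≤ n) :
    distProb n k (d + 2 * j) ≤ distProb n k d := by
  induction j with
  | zero => simp
  | succ j ih =>
    exact (distProb_add_two_le k (d := d + 2 * j) (by omega)).trans (ih (by omega))

/-- Entropy increases only up to 1/2, so a distance above n/2 is first lowered by even steps, which
can only raise the probability. The hypothesis `hn` says (n - 3)/2 ≥ ηn, so the lowered distance is
still at least ηn. -/
theorem distProb_le_exp {n : ℕ} {η : ℝ} (hη : 0 < η) (hη' : η ≤ 2⁻¹)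
    (hn : 3 / 2 ≤ (1 / 2 - η) * n) (k : ℕ) {d : ℕ} (hd : d ≤ n) (hηd : η * n ≤ d) :
    distProb n k d ≤ Real.exp (-(n * Real.binEntropy η / 2)) := by
  have hn3 : 3 ≤ n := by
    have h : 0 ≤ η * n := by positivity
    have : (3 : ℝ) ≤ n := by linarith
    exact_mod_cast this
  have hn0 : (0 : ℝ) < n := by positivity
  obtain ⟨e, he, hen, hηe⟩ : ∃ e, distProb n k d ≤ distProb n k e ∧ 2 * e ≤ n ∧ η * n ≤ e := by
    rcases le_or_gt (2 * d) n with h | h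
    · exact ⟨d, le_rfl, h, hηd⟩
    · obtain ⟨e, j, hj, h1, h2⟩ : ∃ e j, d = e + 2 * j ∧ 2 * e ≤ n ∧ n ≤ 2 * e + 3 := by
        -- The quotient by 4 puts twice the new distance in [n - 3, n].
        refine ⟨d - 2 * ((2 * d - n + 3) / 4), (2 * d - n + 3) / 4, ?_, ?_, ?_⟩ <;> omega
      refine ⟨e, ?_, h1, ?_⟩
      · subst hj
        exact distProb_le_distProb_of_even hd
      · have : (n : ℝ) ≤ 2 * e + 3 := by exact_mod_cast h2
        linarith
  have he0 : 0 < e := by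
    have : (0 : ℝ) < e := lt_of_lt_of_le (by positivity) hηe
    exact_mod_cast this
  have hen' : e < n := by omega
  have hen2 : (2 * e : ℝ) ≤ n := by exact_mod_cast hen
  refine he.trans ?_
  have h1 := choose_mul_distProb_le_one (by omega) k hen'.le
  have h2 := exp_binEntropy_le_choose_sq he0 hen'
  have h3 : Real.binEntropy η ≤ Real.binEntropy (e / n) := by
    refine Real.binEntropy_strictMonoOn.monotoneOn ⟨hη.le, hη'⟩ ⟨by positivity, ?_⟩ ?_
    · rw [div_le_iff₀ hn0]; linarith
    · rwa [le_div_iff₀ hn0]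
  have h4 : Real.exp (n * Real.binEntropy η / 2) ≤ n.choose e := by
    rw [← abs_of_nonneg (by positivity : (0 : ℝ) ≤ n.choose e)]
    refine Real.le_sqrt_of_sq_le ?_ |>.trans_eq (Real.sqrt_sq_eq_abs _)
    rw [← Real.exp_nat_mul]
    refine le_trans (Real.exp_le_exp.2 ?_) h2
    have := mul_le_mul_of_nonneg_left h3 hn0.le
    push_cast
    linarith
  rw [Real.exp_neg, ← one_div, le_div_iff₀ (Real.exp_pos _), mul_comm]
  exact (mul_le_mul_of_nonneg_right h4 (distProb_nonneg k hen'.le)).trans h1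

/-! ### Hitting times and their exponentials -/

section hittingTime

variable {V Ω : Type*} {Y : ℕ → Ω → V} {B : Set V} {ω : Ω}

theorem hittingTime_eq_coe_iff {k : ℕ} :
    hittingTime Y B ω = k ↔ (∀ i < k, Y i ω ∉ B) ∧ Y k ω ∈ B := by
  have hle : ∀ j : ℕ, hittingTime Y B ω ≤ j ↔ ∃ i ≤ j, Y i ω ∈ B := by
    intro j
    have h : hittingTime Y B ω ≤ j ↔ ∃ i ∈ Set.Icc 0 j, Y i ω ∈ B := hittingAfter_le_iff
    simpa using h
  constructor
  · intro h
    have h1 : ∀ i < k, Y i ω ∉ B := by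
      intro i hi hB
      have := (hle i).2 ⟨i, le_rfl, hB⟩
      rw [h] at this
      exact absurd (Nat.cast_le.1 this) (by omega)
    obtain ⟨i, hi, hB⟩ := (hle k).1 h.le
    rcases hi.eq_or_lt with rfl | hlt
    · exact ⟨h1, hB⟩
    · exact absurd hB (h1 i hlt)
  · rintro ⟨h1, h2⟩
    refine le_antisymm ((hle k).2 ⟨k, le_rfl, h2⟩) ?_
    by_contra hlt
    rw [not_le] at hlt
    lift hittingTime Y B ω to ℕ using hlt.ne_top with j hj
    obtain ⟨i, hi, hB⟩ := (hle j).1 le_rfl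
    exact h1 i (lt_of_le_of_lt hi (by exact_mod_cast hlt)) hB

theorem expNeg_nonneg (a : ℝ) (h : ℕ∞) : 0 ≤ expNeg a h := by
  unfold expNeg
  split_ifs
  · rfl
  · positivity

theorem expNeg_le_one {a : ℝ} (ha : 0 ≤ a) (h : ℕ∞) : expNeg a h ≤ 1 := by
  unfold expNeg
  split_ifs
  · exact zero_le_one
  · exact Real.exp_le_one_iff.2 (neg_nonpos.2 (by positivity))

theorem expNeg_coe (a : ℝ) (k : ℕ) : expNeg a k = Real.exp (-a) ^ k := by
  rw [expNeg, if_neg (ENat.natCast_ne_top k), ENat.toNat_natCast, ← Real.exp_nat_mul]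
  congr 1
  ring

end hittingTime

/-! ### The walk killed on entering a set, and optional stopping -/

namespace IsSimpleRandomWalk

variable {V Ω : Type*} [Fintype V] [MeasurableSpace Ω] {G : SimpleGraph V} [G.LocallyFinite]
  {P : Measure Ω} {Y : ℕ → Ω → V} {x : V}

theorem measurableSet_avoid (h : IsSimpleRandomWalk G P Y x) (B : Set V) (k : ℕ) (u : V) :
    MeasurableSet {ω | (∀ i < k, Y i ω ∉ B) ∧ Y k ω = u} := by
  have h1 : ∀ i, MeasurableSet {ω | Y i ω ∈ B} := by
    intro i
    have : {ω | Y i ω ∈ B} = ⋃ v ∈ B, {ω | Y i ω = v} := by ext ω; simp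
    rw [this]
    exact MeasurableSet.biUnion B.to_countable fun v _ => h.measurable i v
  have h2 : {ω | (∀ i < k, Y i ω ∉ B) ∧ Y k ω = u} =
      (⋂ i ∈ Set.Iio k, {ω | Y i ω ∈ B}ᶜ) ∩ {ω | Y k ω = u} := by
    ext ω; simp
  rw [h2]
  exact (MeasurableSet.biInter (Set.Iio k).to_countable fun i _ => (h1 i).compl).inter
    (h.measurable k u)

open scoped Classical in
/-- The Markov property at time `k` for the walk killed upon entering `B`. -/
theorem measure_avoid_step (h : IsSimpleRandomWalk G P Y x) (B : Set V) (k : ℕ) (u v : V) :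
    P {ω | ((∀ i < k, Y i ω ∉ B) ∧ Y k ω = u) ∧ Y (k + 1) ω = v} =
      P {ω | (∀ i < k, Y i ω ∉ B) ∧ Y k ω = u} *
        (if G.Adj u v then (G.degree u : ℝ≥0∞)⁻¹ else 0) := by
  -- The axiom `step` concerns whole trajectories, so the event is cut into finitely many disjoint
  -- cylinders, indexed by the positions at times 0, …, k; `path` continues each one by v.
  obtain ⟨path, hpath, hlast⟩ : ∃ path : (Fin (k + 1) → V) → ℕ → V,
      (∀ y i (hi : i < k + 1), path y i = y ⟨i, hi⟩) ∧ ∀ y, path y (k + 1) = v :=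
    ⟨fun y i => if hi : i < k + 1 then y ⟨i, hi⟩ else v, fun y i hi => dif_pos hi,
      fun y => dif_neg (lt_irrefl _)⟩
  have hcyl : ∀ y m, MeasurableSet {ω | ∀ i ≤ m, Y i ω = path y i} := by
    intro y m
    have : {ω | ∀ i ≤ m, Y i ω = path y i} = ⋂ i ∈ Set.Iic m, {ω | Y i ω = path y i} := by
      ext ω; simp
    rw [this]
    exact MeasurableSet.biInter (Set.Iic m).to_countable fun i _ => h.measurable i _
  have hdisj : ∀ m, k ≤ m → ∀ S : Finset (Fin (k + 1) → V),
      (S : Set (Fin (k + 1) → V)).PairwiseDisjoint fun y => {ω | ∀ i ≤ m, Y i ω = path y i} := by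
    intro m hm S y _ y' _ hne
    refine Set.disjoint_left.2 fun ω h1 h2 => hne (funext fun i => ?_)
    rw [← hpath y i i.2, ← hpath y' i i.2, ← h1 i (by omega), ← h2 i (by omega)]
  let S : Finset (Fin (k + 1) → V) :=
    Finset.univ.filter fun y => (∀ i < k, path y i ∉ B) ∧ path y k = u
  have hS : ∀ y, y ∈ S ↔ (∀ i < k, path y i ∉ B) ∧ path y k = u := by intro y; simp [S]
  have key : ∀ ω, ∀ i < k + 1, path (fun j : Fin (k + 1) => Y j ω) i = Y i ω := by
    intro ω i hi; rw [hpath _ i hi]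
  have e1 : {ω | (∀ i < k, Y i ω ∉ B) ∧ Y k ω = u} =
      ⋃ y ∈ S, {ω | ∀ i ≤ k, Y i ω = path y i} := by
    ext ω
    simp only [Set.mem_iUnion, Set.mem_ofPred_eq, exists_prop, hS]
    constructor
    · rintro ⟨h1, h2⟩
      refine ⟨fun j => Y j ω, ⟨fun i hi => ?_, ?_⟩, fun i hi => ?_⟩
      · rw [key ω i (by omega)]; exact h1 i hi
      · rw [key ω k (by omega)]; exact h2
      · rw [key ω i (by omega)]
    · rintro ⟨y, ⟨h1, h2⟩, h3⟩
      exact ⟨fun i hi => by rw [h3 i hi.le]; exact h1 i hi, by rw [h3 k le_rfl, h2]⟩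
  have e2 : {ω | ((∀ i < k, Y i ω ∉ B) ∧ Y k ω = u) ∧ Y (k + 1) ω = v} =
      ⋃ y ∈ S, {ω | ∀ i ≤ k + 1, Y i ω = path y i} := by
    ext ω
    simp only [Set.mem_iUnion, Set.mem_ofPred_eq, exists_prop, hS]
    constructor
    · rintro ⟨⟨h1, h2⟩, h3⟩
      refine ⟨fun j => Y j ω, ⟨fun i hi => ?_, ?_⟩, fun i hi => ?_⟩
      · rw [key ω i (by omega)]; exact h1 i hi
      · rw [key ω k (by omega)]; exact h2
      · rcases hi.eq_or_lt with rfl | hlt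
        · rw [hlast, h3]
        · rw [key ω i (by omega)]
    · rintro ⟨y, ⟨h1, h2⟩, h3⟩
      exact ⟨⟨fun i hi => by rw [h3 i (by omega)]; exact h1 i hi,
        by rw [h3 k (by omega), h2]⟩, by rw [h3 (k + 1) le_rfl, hlast]⟩
  rw [e1, e2, measure_biUnion_finset (hdisj _ (by omega) S) fun y _ => hcyl y _,
    measure_biUnion_finset (hdisj _ le_rfl S) fun y _ => hcyl y _, Finset.sum_mul]
  refine Finset.sum_congr rfl fun y hy => ?_
  rw [h.step k (path y), hlast, ((hS y).1 hy).2]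

open scoped Classical in
theorem measureReal_avoid_succ (h : IsSimpleRandomWalk G P Y x) (B : Set V) (k : ℕ) (v : V) :
    P.real {ω | (∀ i < k + 1, Y i ω ∉ B) ∧ Y (k + 1) ω = v} =
      ∑ u, if u ∈ B then 0 else P.real {ω | (∀ i < k, Y i ω ∉ B) ∧ Y k ω = u} *
        (if G.Adj u v then (G.degree u : ℝ)⁻¹ else 0) := by
  have := h.isProbabilityMeasure
  have e1 : {ω | (∀ i < k + 1, Y i ω ∉ B) ∧ Y (k + 1) ω = v} =
      ⋃ u ∈ Finset.univ.filter (· ∉ B),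
        {ω | ((∀ i < k, Y i ω ∉ B) ∧ Y k ω = u) ∧ Y (k + 1) ω = v} := by
    ext ω
    simp only [Set.mem_iUnion, Set.mem_ofPred_eq, exists_prop, Finset.mem_filter,
      Finset.mem_univ, true_and]
    constructor
    · rintro ⟨h1, h2⟩
      exact ⟨Y k ω, h1 k (by omega), ⟨fun i hi => h1 i (by omega), rfl⟩, h2⟩
    · rintro ⟨u, hu, ⟨h1, rfl⟩, h3⟩
      refine ⟨fun i hi => ?_, h3⟩
      rcases Nat.lt_or_ge i k with h4 | h4
      · exact h1 i h4
      · obtain rfl : i = k := by omega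
        exact hu
  rw [e1, measureReal_biUnion_finset, Finset.sum_filter]
  · refine Finset.sum_congr rfl fun u _ => ?_
    by_cases hu : u ∈ B
    · simp [hu]
    · rw [if_pos hu, if_neg hu, measureReal_def, h.measure_avoid_step, ENNReal.toReal_mul,
        measureReal_def]
      split_ifs <;> simp
  · intro u _ u' _ hne
    exact Set.disjoint_left.2 fun ω h1 h2 => hne (h1.1.2.symm.trans h2.1.2)
  · exact fun u _ => (h.measurableSet_avoid B k u).inter (h.measurable (k + 1) v)

open scoped Classical in
theorem measureReal_hittingTime_eq (h : IsSimpleRandomWalk G P Y x) (B : Set V) (k : ℕ) :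
    P.real {ω | hittingTime Y B ω = k} =
      ∑ u, if u ∈ B then P.real {ω | (∀ i < k, Y i ω ∉ B) ∧ Y k ω = u} else 0 := by
  have := h.isProbabilityMeasure
  have e1 : {ω | hittingTime Y B ω = k} = ⋃ u ∈ Finset.univ.filter (· ∈ B),
      {ω | (∀ i < k, Y i ω ∉ B) ∧ Y k ω = u} := by
    ext ω
    simp [hittingTime_eq_coe_iff, and_comm]
  rw [e1, measureReal_biUnion_finset, Finset.sum_filter]
  · intro u _ u' _ hne
    exact Set.disjoint_left.2 fun ω h1 h2 => hne (h1.2.symm.trans h2.2)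
  · exact fun u _ => h.measurableSet_avoid B k u

theorem measurableSet_hittingTime_eq (h : IsSimpleRandomWalk G P Y x) (B : Set V) (k : ℕ) :
    MeasurableSet {ω | hittingTime Y B ω = k} := by
  have e1 : {ω | hittingTime Y B ω = k} = ⋃ u ∈ B, {ω | (∀ i < k, Y i ω ∉ B) ∧ Y k ω = u} := by
    ext ω
    simp [hittingTime_eq_coe_iff, and_comm]
  rw [e1]
  exact MeasurableSet.biUnion B.to_countable fun u _ => h.measurableSet_avoid B k u

theorem measurable_hittingTime (h : IsSimpleRandomWalk G P Y x) (B : Set V) :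
    Measurable (hittingTime Y B) := by
  refine measurable_to_countable' fun t => ?_
  induction t using ENat.recTopCoe with
  | top =>
    have : hittingTime Y B ⁻¹' {⊤} = (⋃ k : ℕ, {ω | hittingTime Y B ω = k})ᶜ := by
      ext ω
      simp only [Set.mem_preimage, Set.mem_singleton_iff, Set.mem_compl_iff, Set.mem_iUnion,
        Set.mem_ofPred_eq, not_exists]
      constructor
      · intro h1 k h2
        exact ENat.natCast_ne_top k (h2.symm.trans h1)
      · intro h1
        by_contra h2
        exact h1 _ (ENat.natCast_toNat h2).symm
    rw [this]
    exact (MeasurableSet.iUnion fun k => h.measurableSet_hittingTime_eq B k).compl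
  | coe k => exact h.measurableSet_hittingTime_eq B k

theorem measurable_expNeg_hittingTime (h : IsSimpleRandomWalk G P Y x) (B : Set V) (a : ℝ) :
    Measurable fun ω => expNeg a (hittingTime Y B ω) :=
  (measurable_from_top (f := expNeg a)).comp (h.measurable_hittingTime B)

theorem integrable_expNeg_hittingTime (h : IsSimpleRandomWalk G P Y x) (B : Set V) {a : ℝ}
    (ha : 0 ≤ a) : Integrable (fun ω => expNeg a (hittingTime Y B ω)) P := by
  have := h.isProbabilityMeasure
  refine Integrable.of_bound (h.measurable_expNeg_hittingTime B a).aestronglyMeasurable 1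
    (Eventually.of_forall fun ω => ?_)
  rw [Real.norm_eq_abs, abs_of_nonneg (expNeg_nonneg _ _)]
  exact expNeg_le_one ha _

/-- The truncated sum misses only the event H ≥ N, where the integrand is at most exp(-aN); it
vanishes for H = ∞. -/
theorem abs_integral_expNeg_sub_sum_le (h : IsSimpleRandomWalk G P Y x) (B : Set V) {a : ℝ}
    (ha : 0 ≤ a) (N : ℕ) :
    |∫ ω, expNeg a (hittingTime Y B ω) ∂P -
      ∑ k ∈ Finset.range N, Real.exp (-a) ^ k * P.real {ω | hittingTime Y B ω = k}| ≤
      Real.exp (-a) ^ N := by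
  have := h.isProbabilityMeasure
  have hl1 : Real.exp (-a) ≤ 1 := Real.exp_le_one_iff.2 (neg_nonpos.2 ha)
  have e1 : ∀ k : ℕ, Real.exp (-a) ^ k * P.real {ω | hittingTime Y B ω = k} =
      ∫ ω, Real.exp (-a) ^ k * Set.indicator {ω | hittingTime Y B ω = k} 1 ω ∂P := by
    intro k
    rw [integral_const_mul, integral_indicator_one (h.measurableSet_hittingTime_eq B k)]
  have hint : ∀ k : ℕ, Integrable (fun ω => Real.exp (-a) ^ k *
      Set.indicator {ω | hittingTime Y B ω = k} (1 : Ω → ℝ) ω) P := fun k =>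
    ((integrable_const (1 : ℝ)).indicator (h.measurableSet_hittingTime_eq B k)).const_mul _
  simp only [e1]
  rw [← integral_finsetSum _ fun k _ => hint k, ← integral_sub
    (h.integrable_expNeg_hittingTime B ha) (integrable_finsetSum _ fun k _ => hint k),
    ← Real.norm_eq_abs]
  refine (norm_integral_le_of_norm_le_const (C := Real.exp (-a) ^ N)
    (Eventually.of_forall fun ω => ?_)).trans (by simp)
  rcases eq_or_ne (hittingTime Y B ω) ⊤ with ht | ht
  · have : ∀ k : ℕ, Set.indicator {ω | hittingTime Y B ω = k} (1 : Ω → ℝ) ω = 0 := by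
      intro k
      refine Set.indicator_of_notMem (fun hk => ?_) _
      exact ENat.natCast_ne_top k (Eq.trans (Eq.symm hk) ht)
    simp only [this, mul_zero, Finset.sum_const_zero, sub_zero, ht, expNeg, if_true, norm_zero]
    positivity
  · obtain ⟨m, hm⟩ := ENat.ne_top_iff_exists.1 ht
    have : ∀ k : ℕ, Set.indicator {ω | hittingTime Y B ω = k} (1 : Ω → ℝ) ω =
        if k = m then 1 else 0 := by
      intro k
      simp only [Set.indicator_apply, Set.mem_ofPred_eq, ← hm, Pi.one_apply, Nat.cast_inj,
        eq_comm]
    simp only [this, ← hm, expNeg_coe, mul_ite, mul_one, mul_zero, Finset.sum_ite_eq',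
      Finset.mem_range]
    split_ifs with hmN
    · simp only [sub_self, norm_zero]; positivity
    · rw [sub_zero, Real.norm_eq_abs, abs_of_nonneg (by positivity)]
      exact pow_le_pow_of_le_one (Real.exp_pos _).le hl1 (by omega)

open scoped Classical in
/-- If `f` satisfies the Laplace equation of the killed walk off `B` and is close to `L` on `B`,
then `f x` is close to `L` times the Laplace transform of the hitting time of `B`. -/
theorem abs_sub_mul_integral_expNeg_le (h : IsSimpleRandomWalk G P Y x) (B : Set V) {a : ℝ}
    (ha : 0 < a) (f : V → ℝ) (hf : ∀ u ∉ B, f u = Real.exp (-a) *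
      ∑ v, (if G.Adj u v then (G.degree u : ℝ)⁻¹ else 0) * f v)
    {L δ : ℝ} (hδ : 0 ≤ δ) (hL : ∀ u ∈ B, |f u - L| ≤ δ) :
    |f x - L * ∫ ω, expNeg a (hittingTime Y B ω) ∂P| ≤ δ := by
  have := h.isProbabilityMeasure
  set l := Real.exp (-a) with hl
  have hl0 : 0 < l := Real.exp_pos _
  have hl1 : l < 1 := Real.exp_lt_one_iff.2 (neg_lt_zero.2 ha)
  set p : ℕ → V → ℝ := fun k u => P.real {ω | (∀ i < k, Y i ω ∉ B) ∧ Y k ω = u} with hp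
  set b : ℕ → ℝ := fun k => P.real {ω | hittingTime Y B ω = k} with hb
  have hp0 : ∀ k u, 0 ≤ p k u := fun k u => measureReal_nonneg
  have hp1 : ∀ k u, p k u ≤ 1 := fun k u => measureReal_le_one
  have hpb : ∀ k, b k = ∑ u, if u ∈ B then p k u else 0 := h.measureReal_hittingTime_eq B
  -- Mass in B is absorbed; mass outside B moves on by one step, by the equation for f.
  have hrec : ∀ k, ∑ u, p k u * f u = (∑ u, if u ∈ B then p k u * f u else 0) +
      l * ∑ u, p (k + 1) u * f u := by
    intro k
    have e1 : ∀ u, p k u * f u = (if u ∈ B then p k u * f u else 0) +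
        if u ∈ B then 0 else p k u * f u := by intro u; split_ifs <;> simp
    rw [Finset.sum_congr rfl fun u _ => e1 u, Finset.sum_add_distrib]
    congr 1
    have e2 : ∀ v, p (k + 1) v * f v = ∑ u, if u ∈ B then 0 else
        p k u * (if G.Adj u v then (G.degree u : ℝ)⁻¹ else 0) * f v := by
      intro v
      simp only [hp]
      rw [h.measureReal_avoid_succ B k v, Finset.sum_mul]
      refine Finset.sum_congr rfl fun u _ => ?_
      split_ifs <;> simp
    rw [Finset.sum_congr rfl fun v _ => e2 v, Finset.sum_comm, Finset.mul_sum]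
    refine Finset.sum_congr rfl fun u _ => ?_
    by_cases hu : u ∈ B
    · simp [hu]
    · simp only [hu, if_false]
      rw [hf u hu]
      simp only [Finset.mul_sum]
      refine Finset.sum_congr rfl fun v _ => ?_
      ring
  have hiter : ∀ N, ∑ u, p 0 u * f u =
      (∑ k ∈ Finset.range N, l ^ k * ∑ u, if u ∈ B then p k u * f u else 0) +
      l ^ N * ∑ u, p N u * f u := by
    intro N
    induction N with
    | zero => simp
    | succ N ih =>
      rw [ih, hrec N, Finset.sum_range_succ]
      ring
  have hstart : ∑ u, p 0 u * f u = f x := by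
    have : ∀ u, p 0 u = if u = x then 1 else 0 := by
      intro u
      have h1 : P.real {ω | Y 0 ω = u} = P.real {ω : Ω | x = u} := by
        refine measureReal_congr ?_
        filter_upwards [h.start] with ω hω
        simp only [eq_iff_iff]
        change Y 0 ω = u ↔ x = u
        rw [hω]
      simp only [hp, Nat.not_lt_zero, false_imp_iff, implies_true, true_and]
      rw [h1]
      by_cases hu : x = u
      · subst hu; simp
      · simp [hu, Ne.symm hu]
    simp [this]
  have hdiff : ∀ k, |(∑ u, if u ∈ B then p k u * f u else 0) - L * b k| ≤ δ * b k := by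
    intro k
    rw [hpb, Finset.mul_sum, Finset.mul_sum, ← Finset.sum_sub_distrib]
    refine (Finset.abs_sum_le_sum_abs _ _).trans (Finset.sum_le_sum fun u _ => ?_)
    by_cases hu : u ∈ B
    · simp only [hu, if_true]
      rw [show p k u * f u - L * p k u = (f u - L) * p k u by ring, abs_mul,
        abs_of_nonneg (hp0 k u)]
      exact mul_le_mul_of_nonneg_right (hL u hu) (hp0 k u)
    · simp [hu]
  have hb1 : ∀ N, ∑ k ∈ Finset.range N, l ^ k * b k ≤ 1 := by
    intro N
    have h1 : ∑ k ∈ Finset.range N, b k ≤ 1 := by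
      simp only [hb]
      rw [← measureReal_biUnion_finset]
      · exact measureReal_le_one
      · intro i _ j _ hij
        refine Set.disjoint_left.2 fun ω h1 h2 => hij ?_
        exact Nat.cast_injective (R := ℕ∞) (Eq.trans (Eq.symm h1) h2)
      · exact fun k _ => h.measurableSet_hittingTime_eq B k
    refine (Finset.sum_le_sum fun k _ => ?_).trans h1
    exact mul_le_of_le_one_left measureReal_nonneg (pow_le_one₀ hl0.le hl1.le)
  -- Killing makes the remainder at time N geometrically small, so finiteness of the hitting time is
  -- not needed.
  have hN : ∀ N, |f x - L * ∫ ω, expNeg a (hittingTime Y B ω) ∂P| ≤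
      δ + l ^ N * (∑ u, |f u| + |L|) := by
    intro N
    have h1 := h.abs_integral_expNeg_sub_sum_le B ha.le N
    rw [← hl] at h1
    have h2 : |l ^ N * ∑ u, p N u * f u| ≤ l ^ N * ∑ u, |f u| := by
      rw [abs_mul, abs_of_nonneg (by positivity)]
      refine mul_le_mul_of_nonneg_left ((Finset.abs_sum_le_sum_abs _ _).trans
        (Finset.sum_le_sum fun u _ => ?_)) (by positivity)
      rw [abs_mul, abs_of_nonneg (hp0 N u)]
      exact mul_le_of_le_one_left (abs_nonneg _) (hp1 N u)
    have h3 : |(∑ k ∈ Finset.range N, l ^ k * ∑ u, if u ∈ B then p k u * f u else 0) -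
        L * ∑ k ∈ Finset.range N, l ^ k * b k| ≤ δ := by
      rw [Finset.mul_sum, ← Finset.sum_sub_distrib]
      refine (Finset.abs_sum_le_sum_abs _ _).trans ?_
      refine le_trans ?_ (mul_le_of_le_one_right hδ (hb1 N))
      rw [Finset.mul_sum]
      refine Finset.sum_le_sum fun k _ => ?_
      rw [show ∀ z, l ^ k * z - L * (l ^ k * b k) = l ^ k * (z - L * b k) by intro z; ring,
        abs_mul, abs_of_nonneg (by positivity), show δ * (l ^ k * b k) = l ^ k * (δ * b k) by ring]
      exact mul_le_mul_of_nonneg_left (hdiff k) (by positivity)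
    have h4 : |L * (∫ ω, expNeg a (hittingTime Y B ω) ∂P -
        ∑ k ∈ Finset.range N, l ^ k * b k)| ≤ l ^ N * |L| := by
      rw [abs_mul, mul_comm]
      exact mul_le_mul_of_nonneg_right h1 (abs_nonneg _)
    rw [← hstart, hiter N]
    rw [abs_le] at h2 h3 h4 ⊢
    rw [mul_add]
    constructor <;> linarith
  have hlim : Tendsto (fun N : ℕ => δ + l ^ N * (∑ u, |f u| + |L|)) atTop (𝓝 δ) := by
    have := (tendsto_pow_atTop_nhds_zero_of_lt_one hl0.le hl1).mul_const (∑ u, |f u| + |L|)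
    simpa using this.const_add δ
  exact ge_of_tendsto' hlim hN

end IsSimpleRandomWalk

/-! ### Asymptotics of the Green function -/

theorem two_pow_div_rpow (γ : ℝ) (n : ℕ) :
    (2 : ℝ) ^ n / 2 ^ (γ * n) = (2 ^ (1 - γ)) ^ n := by
  rw [← Real.rpow_natCast, ← Real.rpow_natCast, ← Real.rpow_mul two_pos.le,
    ← Real.rpow_sub two_pos]
  congr 1
  ring

theorem tendsto_rpow_div_two_pow {γ : ℝ} (hγ : γ < 1) :
    Tendsto (fun n : ℕ => (2 : ℝ) ^ (γ * n) / 2 ^ n) atTop (𝓝 0) := by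
  have h : ∀ n : ℕ, (2 : ℝ) ^ (γ * n) / 2 ^ n = ((2 ^ (1 - γ))⁻¹) ^ n := by
    intro n
    rw [inv_pow, ← two_pow_div_rpow, inv_div]
  simp only [h]
  refine tendsto_pow_atTop_nhds_zero_of_lt_one (by positivity) (inv_lt_one_of_one_lt₀ ?_)
  exact Real.one_lt_rpow one_lt_two (by linarith)

theorem tendsto_rpow_mul_atTop {γ : ℝ} (hγ : 0 < γ) :
    Tendsto (fun n : ℕ => (2 : ℝ) ^ (γ * n)) atTop atTop :=
  (tendsto_rpow_atTop_of_base_gt_one 2 one_lt_two).comp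
    (tendsto_natCast_atTop_atTop.const_mul_atTop hγ)

theorem one_sub_two_div_pow_sq_le {n : ℕ} (hn : 2 ≤ n) :
    (1 - 2 / (n : ℝ)) ^ n ^ 2 ≤ Real.exp (-2) ^ n := by
  have hn0 : (0 : ℝ) < n := by positivity
  have hn2 : (2 : ℝ) ≤ n := by exact_mod_cast hn
  have h0 : 0 ≤ (1 - 2 / (n : ℝ)) := sub_nonneg.2 ((div_le_one hn0).2 hn2)
  have h1 : 1 - 2 / (n : ℝ) ≤ Real.exp (-(2 / n)) := by
    linarith [Real.add_one_le_exp (-(2 / (n : ℝ)))]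
  refine (pow_le_pow_left₀ h0 h1 _).trans_eq ?_
  rw [← Real.exp_nat_mul, ← Real.exp_nat_mul]
  congr 1
  push_cast
  field_simp

theorem tendsto_of_eventually_le_mul_pow {u : ℕ → ℝ} {r : ℝ} (hr : 0 ≤ r) (hr' : r < 1) (C : ℝ)
    (j : ℕ) (h0 : ∀ᶠ n in atTop, 0 ≤ u n)
    (h : ∀ᶠ n : ℕ in atTop, u n ≤ C * ((n : ℝ) ^ j * r ^ n)) : Tendsto u atTop (𝓝 0) := by
  refine tendsto_of_tendsto_of_tendsto_of_le_of_le' tendsto_const_nhds ?_ h0 h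
  simpa using (tendsto_pow_const_mul_const_pow_of_lt_one j hr hr').const_mul C

/-- At distances `≥ η n` the Green function differs from that of the uniform distribution by much
less than `2 ^ (-(1 - γ) n)`. -/
theorem exists_abs_distGreen_sub_le {γ η : ℝ} (hγ : 0 < γ) (hη : 0 < η)
    (hη' : η < 2⁻¹) (hent : 2 * (1 - γ) * Real.log 2 < Real.binEntropy η) :
    ∃ E : ℕ → ℝ, (∀ᶠ n in atTop, 0 ≤ E n) ∧
      Tendsto (fun n : ℕ => (2 : ℝ) ^ n / 2 ^ (γ * n) * E n) atTop (𝓝 0) ∧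
      ∀ᶠ n : ℕ in atTop, ∀ l : ℝ, 0 ≤ l → l < 1 → ∀ x y : Cube n, η * n ≤ hammingDist x y →
        |distGreen n l (hammingDist x y) - 1 / (2 ^ n * (1 - l))| ≤ E n := by
  set r : ℝ := 2 ^ (1 - γ) with hr
  have hr0 : 0 < r := by positivity
  have hr2 : r < 2 := by
    rw [hr]
    conv_rhs => rw [← Real.rpow_one 2]
    exact Real.rpow_lt_rpow_of_exponent_lt one_lt_two (by linarith)
  set h := Real.exp (-(Real.binEntropy η / 2)) with hh
  -- This is the entropy condition `hent`: 1 / C(n, ηn) ≲ h^n must beat the growth r^n of the number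
  -- of points.
  have hrh : r * h < 1 := by
    rw [hr, hh, Real.rpow_def_of_pos two_pos, ← Real.exp_add, Real.exp_lt_one_iff]
    linarith
  have hpow : ∀ n : ℕ, Real.exp (-(n * Real.binEntropy η / 2)) = h ^ n := by
    intro n
    rw [hh, ← Real.exp_nat_mul]
    congr 1
    ring
  have hex : r * Real.exp (-2) < 1 := by
    rw [Real.exp_neg, ← div_eq_mul_inv, div_lt_one (Real.exp_pos _)]
    linarith [Real.add_one_le_exp (2 : ℝ)]
  refine ⟨fun n => (n : ℝ) ^ 2 * h ^ n +
    (((n : ℝ) ^ 2 + 1) / 2 ^ n + n * (1 - 2 / n) ^ n ^ 2), ?_, ?_, ?_⟩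
  · filter_upwards [eventually_ge_atTop 2] with n hn
    have hn0 : (0 : ℝ) < n := by positivity
    have hn2 : (2 : ℝ) ≤ n := by exact_mod_cast hn
    have h0 : 0 ≤ (1 - 2 / (n : ℝ)) := sub_nonneg.2 ((div_le_one hn0).2 hn2)
    positivity
  · simp only [two_pow_div_rpow, ← hr, mul_add]
    have t1 : Tendsto (fun n : ℕ => r ^ n * ((n : ℝ) ^ 2 * h ^ n)) atTop (𝓝 0) := by
      refine tendsto_of_eventually_le_mul_pow (r := r * h) (by positivity) hrh 1 2
        (Eventually.of_forall fun n => by positivity) (Eventually.of_forall fun n => ?_)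
      rw [mul_pow]
      exact le_of_eq (by ring)
    have t2 : Tendsto (fun n : ℕ => r ^ n * (((n : ℝ) ^ 2 + 1) / 2 ^ n)) atTop (𝓝 0) := by
      refine tendsto_of_eventually_le_mul_pow (r := r / 2) (by positivity) (by linarith) 2 2
        (Eventually.of_forall fun n => by positivity) ?_
      filter_upwards [eventually_ge_atTop 1] with n hn
      have hn1 : (1 : ℝ) ≤ n := by exact_mod_cast hn
      have : (n : ℝ) ^ 2 + 1 ≤ 2 * n ^ 2 := by nlinarith
      rw [div_pow]
      calc r ^ n * (((n : ℝ) ^ 2 + 1) / 2 ^ n) ≤ r ^ n * ((2 * n ^ 2) / 2 ^ n) := by gcongr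
        _ = _ := by ring
    have t3 : Tendsto (fun n : ℕ => r ^ n * (n * (1 - 2 / (n : ℝ)) ^ n ^ 2)) atTop (𝓝 0) := by
      refine tendsto_of_eventually_le_mul_pow (r := r * Real.exp (-2)) (by positivity) hex 1 1
        ?_ ?_
      · filter_upwards [eventually_ge_atTop 2] with n hn
        have hn0 : (0 : ℝ) < n := by positivity
        have hn2 : (2 : ℝ) ≤ n := by exact_mod_cast hn
        have h0 : 0 ≤ (1 - 2 / (n : ℝ)) := sub_nonneg.2 ((div_le_one hn0).2 hn2)
        positivity
      · filter_upwards [eventually_ge_atTop 2] with n hn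
        rw [mul_pow]
        calc r ^ n * (n * (1 - 2 / (n : ℝ)) ^ n ^ 2) ≤ r ^ n * (n * Real.exp (-2) ^ n) := by
              gcongr
              exact one_sub_two_div_pow_sq_le hn
          _ = _ := by ring
    simpa using t1.add (t2.add t3)
  · have hlarge : ∀ᶠ n : ℕ in atTop, 3 / 2 ≤ (1 / 2 - η) * (n : ℝ) :=
      (tendsto_natCast_atTop_atTop.const_mul_atTop (by norm_num at hη' ⊢; linarith)).eventually_ge_atTop _
    filter_upwards [eventually_ge_atTop 2, hlarge] with n hn hn' l hl hl' x y hxy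
    -- The cutoff n² makes the spectral error at most n exp(-2n), while the number of early times
    -- stays polynomial.
    have h1 := abs_distGreen_sub_le hn hl hl' x y (n ^ 2)
    have hd := hammingDist_le_dim x y
    have h2 : |∑ k ∈ Finset.range (n ^ 2), l ^ k * distProb n k (hammingDist x y)| ≤
        (n : ℝ) ^ 2 * h ^ n := by
      rw [abs_of_nonneg (Finset.sum_nonneg fun k _ =>
        mul_nonneg (by positivity) (distProb_nonneg k hd))]
      refine (Finset.sum_le_card_nsmul _ _ (h ^ n) fun k _ => ?_).trans (by simp)
      refine (mul_le_of_le_one_left (distProb_nonneg k hd) (pow_le_one₀ hl hl'.le)).trans ?_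
      rw [← hpow]
      exact distProb_le_exp hη hη'.le hn' k hd hxy
    push_cast at h1
    rw [abs_le] at h1 h2 ⊢
    constructor <;> linarith

theorem exists_abs_distGreen_zero_sub_one_le :
    ∃ E : ℕ → ℝ, Tendsto E atTop (𝓝 0) ∧ ∀ᶠ n : ℕ in atTop, ∀ l : ℝ, 0 ≤ l → l < 1 →
      |distGreen n l 0 - 1| ≤ E n + 1 / (2 ^ n * (1 - l)) := by
  refine ⟨fun n => 1135 / (n : ℝ) + (((n : ℝ) ^ 2 + 1) / 2 ^ n + n * Real.exp (-2) ^ n), ?_, ?_⟩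
  · have t1 : Tendsto (fun n : ℕ => (1135 : ℝ) / n) atTop (𝓝 0) :=
      tendsto_const_div_atTop_nhds_zero_nat _
    have t2 : Tendsto (fun n : ℕ => ((n : ℝ) ^ 2 + 1) / 2 ^ n) atTop (𝓝 0) := by
      refine tendsto_of_eventually_le_mul_pow (r := 1 / 2) (by positivity) (by norm_num) 2 2
        (Eventually.of_forall fun n => by positivity) ?_
      filter_upwards [eventually_ge_atTop 1] with n hn
      have hn1 : (1 : ℝ) ≤ n := by exact_mod_cast hn
      have : (n : ℝ) ^ 2 + 1 ≤ 2 * n ^ 2 := by nlinarith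
      rw [div_pow, one_pow]
      calc ((n : ℝ) ^ 2 + 1) / 2 ^ n ≤ (2 * n ^ 2) / 2 ^ n := by gcongr
        _ = _ := by ring
    have t3 : Tendsto (fun n : ℕ => (n : ℝ) * Real.exp (-2) ^ n) atTop (𝓝 0) :=
      tendsto_self_mul_const_pow_of_lt_one (Real.exp_pos _).le (Real.exp_lt_one_iff.2 (by norm_num))
    simpa using t1.add (t2.add t3)
  · filter_upwards [eventually_ge_atTop 3] with n hn l hl hl'
    have hn0 : (0 : ℝ) < n := by positivity
    have h1 := abs_distGreen_sub_le (by omega) hl hl' (1 : Cube n) 1 (n ^ 2)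
    rw [hammingDist_self] at h1
    have h3 : (n : ℝ) * (1 - 2 / n) ^ n ^ 2 ≤ n * Real.exp (-2) ^ n := by
      gcongr
      exact one_sub_two_div_pow_sq_le (by omega)
    have hterm : ∀ k, 0 ≤ l ^ k * distProb n k 0 := fun k =>
      mul_nonneg (by positivity) (distProb_nonneg k (Nat.zero_le _))
    have hterm' : ∀ k, l ^ k * distProb n k 0 ≤ distProb n k 0 := fun k =>
      mul_le_of_le_one_left (distProb_nonneg k (Nat.zero_le _)) (pow_le_one₀ hl hl'.le)
    have h2 : |∑ k ∈ Finset.range (n ^ 2), l ^ k * distProb n k 0 - 1| ≤ 1135 / (n : ℝ) := by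
      -- Time 0 contributes 1, times 1 to 5 at most 27/n each, and the remaining times below n² at
      -- most 1000/n³ each; hence 135 + 1000 = 1135.
      have hsq : n ^ 2 = 5 + (n ^ 2 - 6) + 1 := by
        have : 9 ≤ n ^ 2 := by nlinarith
        omega
      rw [hsq, Finset.sum_range_succ', pow_zero, one_mul, distProb, if_pos rfl,
        add_sub_cancel_right, abs_of_nonneg (Finset.sum_nonneg fun k _ => hterm _),
        Finset.sum_range_add]
      have b1 : ∑ k ∈ Finset.range 5, l ^ (k + 1) * distProb n (k + 1) 0 ≤ 135 / n := by
        refine (Finset.sum_le_card_nsmul _ _ (27 / (n : ℝ)) fun k _ =>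
          (hterm' _).trans (distProb_zero_le hn (by omega))).trans_eq ?_
        rw [Finset.card_range, nsmul_eq_mul]
        push_cast
        ring
      have b2 : ∑ k ∈ Finset.range (n ^ 2 - 6), l ^ (5 + k + 1) * distProb n (5 + k + 1) 0 ≤
          1000 / n := by
        refine (Finset.sum_le_card_nsmul _ _ (1000 / (n : ℝ) ^ 3) fun k _ =>
          (hterm' _).trans (distProb_zero_le_inv_cube hn (by omega))).trans ?_
        rw [Finset.card_range, nsmul_eq_mul]
        have : ((n ^ 2 - 6 : ℕ) : ℝ) ≤ (n : ℝ) ^ 2 := by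
          exact_mod_cast Nat.sub_le _ _
        calc ((n ^ 2 - 6 : ℕ) : ℝ) * (1000 / (n : ℝ) ^ 3) ≤ (n : ℝ) ^ 2 * (1000 / (n : ℝ) ^ 3) := by
              gcongr
          _ = 1000 / (n : ℝ) := by field_simp
      have : 135 / (n : ℝ) + 1000 / n = 1135 / n := by ring
      linarith
    have h4 : 0 ≤ 1 / (2 ^ n * (1 - l)) := by
      have : 0 < 1 - l := by linarith
      positivity
    push_cast at h1
    rw [abs_le] at h1 h2 ⊢
    constructor <;> linarith

/-! ### Laplace transforms for positive parameter -/

theorem tendsto_mul_one_sub_exp_neg_div {N : ℕ → ℝ} (hN : Tendsto N atTop atTop) (s : ℝ) :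
    Tendsto (fun n => N n * (1 - Real.exp (-(s / N n)))) atTop (𝓝 s) := by
  have hd : HasDerivAt (fun t : ℝ => 1 - Real.exp (-(s * t))) s 0 := by
    have := (((hasDerivAt_id (0 : ℝ)).const_mul s).neg.exp).const_sub 1
    simpa using this
  have h1 := hd.tendsto_slope_zero_right
  have h2 : Tendsto (fun n => (N n)⁻¹) atTop (𝓝[>] 0) := tendsto_inv_atTop_nhdsGT_zero.comp hN
  refine (h1.comp h2).congr fun n => ?_
  simp [div_eq_mul_inv]

theorem sum_adj_mul_eq_sum_flipAt {n : ℕ} (f : Cube n → ℝ) (u : Cube n) :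
    ∑ v, (if (hypercube n).Adj u v then ((hypercube n).degree u : ℝ)⁻¹ else 0) * f v =
      (∑ c, f (flipAt u c)) / n := by
  rw [hypercube_degree]
  simp only [ite_mul, zero_mul]
  rw [← Finset.sum_filter]
  have : Finset.univ.filter (fun v => (hypercube n).Adj u v) = Finset.univ.image (flipAt u) := by
    ext v
    simp [hypercube_adj_iff]
  rw [this, Finset.sum_image fun c _ c' _ h => flipAt_injective u h, ← Finset.mul_sum]
  ring

/-- The Laplace transform of the hitting time of `A \ {x}`, given estimates of the sums of the
Green function over this set. -/
theorem abs_mul_integral_expNeg_sub_le {n : ℕ} (hn : 1 ≤ n) {Ω : Type*} [MeasurableSpace Ω]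
    {P : Measure Ω} {Y : ℕ → Ω → Cube n} {x : Cube n}
    (h : IsSimpleRandomWalk (hypercube n) P Y x) (A : Finset (Cube n)) (hx : x ∈ A) {a : ℝ}
    (ha : 0 < a) {M δ δ' γ₀ : ℝ}
    (hsum : ∀ v ∈ A, |(∑ y ∈ A.erase v, distGreen n (Real.exp (-a)) (hammingDist v y)) - M| ≤ δ)
    (hzero : |distGreen n (Real.exp (-a)) 0 - 1| ≤ δ')
    (hfar : ∀ v ∈ A, v ≠ x → |distGreen n (Real.exp (-a)) (hammingDist v x)| ≤ γ₀) :
    |M - (1 + M) * ∫ ω, expNeg a (hittingTime Y ((A : Set (Cube n)) \ {x}) ω) ∂P| ≤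
      2 * δ + δ' + |γ₀| := by
  set g := distGreen n (Real.exp (-a)) with hg
  have hl0 : 0 ≤ Real.exp (-a) := (Real.exp_pos _).le
  have hl1 : Real.exp (-a) < 1 := Real.exp_lt_one_iff.2 (neg_lt_zero.2 ha)
  have hδ : 0 ≤ δ := (abs_nonneg _).trans (hsum x hx)
  have hδ' : 0 ≤ δ' := (abs_nonneg _).trans hzero
  set f : Cube n → ℝ := fun v => ∑ y ∈ A.erase x, g (hammingDist v y) with hf
  have hmain := h.abs_sub_mul_integral_expNeg_le ((A : Set (Cube n)) \ {x}) ha f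
    (L := 1 + M) (δ := δ + δ' + |γ₀|) ?_ (by positivity) ?_
  · have h1 := hsum x hx
    change |f x - M| ≤ δ at h1
    rw [abs_le] at h1 hmain ⊢
    constructor <;> linarith
  · intro u hu
    suffices hu' : f u = Real.exp (-a) * ((∑ c, f (flipAt u c)) / n) by
      rw [hu', ← sum_adj_mul_eq_sum_flipAt]
      congr!
    simp only [hf]
    rw [Finset.sum_comm, Finset.sum_div, Finset.mul_sum]
    refine Finset.sum_congr rfl fun y hy => ?_
    rw [hg, distGreen_eq hn hl0 hl1 u y, if_neg, zero_add]
    rintro rfl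
    refine hu ⟨Finset.mem_coe.2 (Finset.mem_of_mem_erase hy), ?_⟩
    simpa using Finset.ne_of_mem_erase hy
  · rintro v ⟨hvA, hvx⟩
    have hvA' : v ∈ A := hvA
    have hvx' : v ≠ x := hvx
    -- Both sides are the sum over all of A: compared with the sum omitting v, f gains the diagonal
    -- value and loses the negligible term at x.
    have h1 : f v + g (hammingDist v x) =
        (∑ y ∈ A.erase v, g (hammingDist v y)) + g 0 := by
      simp only [hf]
      rw [Finset.sum_erase_add _ _ hx, ← hammingDist_self v, Finset.sum_erase_add _ _ hvA']
    have h2 := hsum v hvA'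
    have h3 := (hfar v hvA' hvx').trans (le_abs_self γ₀)
    rw [abs_le] at h2 h3 hzero ⊢
    constructor <;> linarith

section asymptotics

variable {γ η ρ : ℝ} {A : (n : ℕ) → Finset (Cube n)} {dens : ℕ → ℝ} {Ω : ℕ → Type*}
  [∀ n, MeasurableSpace (Ω n)] {P : (n : ℕ) → Cube n → Measure (Ω n)}
  {Y : (n : ℕ) → Cube n → ℕ → Ω n → Cube n}

theorem exists_abs_integral_expNeg_sub_le_of_pos (hγ : 0 < γ) (hγ' : γ < 1) (hη : 0 < η)
    (hη' : η < 2⁻¹) (hent : 2 * (1 - γ) * Real.log 2 < Real.binEntropy η) (hρ : 0 < ρ)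
    (hcard : ∀ n : ℕ, 1 ≤ n → ((A n).card : ℝ) = dens n * 2 ^ n)
    (hdens : Tendsto (fun n : ℕ => dens n * (2 : ℝ) ^ (γ * (n : ℝ))) atTop (𝓝 ρ))
    (hdist : ∀ n : ℕ, 1 ≤ n → ∀ x ∈ A n, ∀ y ∈ A n, x ≠ y → η * n ≤ hammingDist x y)
    (hY : ∀ n : ℕ, 1 ≤ n → ∀ x : Cube n, IsSimpleRandomWalk (hypercube n) (P n x) (Y n x) x)
    {s : ℝ} (hs : 0 < s) :
    ∃ δ : ℕ → ℝ, Tendsto δ atTop (𝓝 0) ∧ ∀ᶠ n : ℕ in atTop, ∀ x ∈ A n,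
      |(∫ ω, expNeg (s / (2 : ℝ) ^ (γ * (n : ℝ)))
          (hittingTime (Y n x) ((A n : Set (Cube n)) \ {x}) ω) ∂(P n x)) - ρ / (s + ρ)| ≤ δ n := by
  obtain ⟨E, hE0, hE, hEb⟩ := exists_abs_distGreen_sub_le hγ hη hη' hent
  obtain ⟨E', hE', hEb'⟩ := exists_abs_distGreen_zero_sub_one_le
  set N : ℕ → ℝ := fun n => (2 : ℝ) ^ (γ * (n : ℝ)) with hN
  have hN0 : ∀ n, 0 < N n := fun n => by simp only [hN]; positivity
  set l : ℕ → ℝ := fun n => Real.exp (-(s / N n)) with hl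
  have hl0 : ∀ n, 0 < l n := fun n => Real.exp_pos _
  have hl1 : ∀ n, l n < 1 := fun n =>
    Real.exp_lt_one_iff.2 (neg_lt_zero.2 (div_pos hs (hN0 n)))
  set U : ℕ → ℝ := fun n => 1 / (2 ^ n * (1 - l n)) with hU
  have hU0 : ∀ n, 0 < U n := fun n => by
    have := sub_pos.2 (hl1 n)
    simp only [hU]
    positivity
  have hNs : Tendsto (fun n => N n * (1 - l n)) atTop (𝓝 s) :=
    tendsto_mul_one_sub_exp_neg_div (tendsto_rpow_mul_atTop hγ) s
  have hUlim : Tendsto U atTop (𝓝 0) := by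
    have := (tendsto_rpow_div_two_pow hγ').div hNs hs.ne'
    rw [zero_div] at this
    refine this.congr fun n => ?_
    have h1 := (hN0 n).ne'
    have h2 := (sub_pos.2 (hl1 n)).ne'
    change N n / 2 ^ n / (N n * (1 - l n)) = U n
    simp only [hU]
    field_simp
  have hAU : Tendsto (fun n => ((A n).card : ℝ) * U n) atTop (𝓝 (ρ / s)) := by
    refine (hdens.div hNs hs.ne').congr' ?_
    filter_upwards [eventually_ge_atTop 1] with n hn
    have h1 := (hN0 n).ne'
    have h2 := (sub_pos.2 (hl1 n)).ne'
    change dens n * N n / (N n * (1 - l n)) = _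
    rw [hcard n hn]
    simp only [hU]
    field_simp
  have hAE : Tendsto (fun n => ((A n).card : ℝ) * E n) atTop (𝓝 0) := by
    have := hdens.mul hE
    rw [mul_zero] at this
    refine this.congr' ?_
    filter_upwards [eventually_ge_atTop 1] with n hn
    have h1 := (hN0 n).ne'
    change dens n * N n * (2 ^ n / N n * E n) = _
    rw [hcard n hn]
    field_simp
  have hEE : Tendsto E atTop (𝓝 0) := by
    refine tendsto_of_tendsto_of_tendsto_of_le_of_le' tendsto_const_nhds hE hE0 ?_
    filter_upwards [hE0] with n hn
    refine le_mul_of_one_le_left hn ?_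
    rw [two_pow_div_rpow]
    exact one_le_pow₀ (Real.one_le_rpow one_le_two (by linarith))
  -- The three errors: replacing each Green function by `U n`, replacing |A| U by its limit ρ/s, and
  -- the one point left out of the sum.
  set δ₁ : ℕ → ℝ := fun n => (A n).card * E n + |(A n).card * U n - ρ / s| + U n with hδ₁
  have hδ₁lim : Tendsto δ₁ atTop (𝓝 0) := by
    have h1 : Tendsto (fun n => |((A n).card : ℝ) * U n - ρ / s|) atTop (𝓝 0) := by
      simpa using (hAU.sub_const (ρ / s)).abs
    simpa using (hAE.add h1).add hUlim
  refine ⟨fun n => 2 * δ₁ n + (E' n + U n) + |E n + U n|, ?_, ?_⟩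
  · simpa using ((hδ₁lim.const_mul 2).add (hE'.add hUlim)).add (hEE.add hUlim).abs
  · filter_upwards [eventually_ge_atTop 1, hEb, hEb', hE0] with n hn hb hb' hE0n x hx
    have hfar : ∀ v ∈ A n, ∀ y ∈ A n, v ≠ y →
        |distGreen n (l n) (hammingDist v y) - U n| ≤ E n := fun v hv y hy hvy =>
      hb (l n) (hl0 n).le (hl1 n) v y (hdist n hn v hv y hy hvy)
    have key := abs_mul_integral_expNeg_sub_le hn (hY n hn x) (A n) hx (a := s / N n)
      (div_pos hs (hN0 n)) (M := ρ / s) (δ := δ₁ n) (δ' := E' n + U n) (γ₀ := E n + U n)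
      ?_ (hb' (l n) (hl0 n).le (hl1 n)) ?_
    · set φ := ∫ ω, expNeg (s / N n)
          (hittingTime (Y n x) ((A n : Set (Cube n)) \ {x}) ω) ∂(P n x)
      -- Solving for φ divides by 1 + ρ/s ≥ 1, which does not enlarge the error.
      have h1 : φ - ρ / (s + ρ) = -((ρ / s - (1 + ρ / s) * φ) * (s / (s + ρ))) := by
        field_simp
        ring
      change |φ - ρ / (s + ρ)| ≤ _
      rw [h1, abs_neg, abs_mul]
      refine (mul_le_of_le_one_right (abs_nonneg _) ?_).trans key
      rw [abs_of_pos (by positivity), div_le_one (by positivity)]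
      linarith
    · intro v hv
      change |∑ y ∈ (A n).erase v, distGreen n (l n) (hammingDist v y) - ρ / s| ≤ δ₁ n
      have hc : (((A n).erase v).card : ℝ) = (A n).card - 1 := by
        rw [Finset.card_erase_of_mem hv, Nat.cast_sub (Finset.card_pos.2 ⟨v, hv⟩), Nat.cast_one]
      have h1 : |∑ y ∈ (A n).erase v, distGreen n (l n) (hammingDist v y) -
          ((A n).card - 1) * U n| ≤ (A n).card * E n := by
        rw [← hc, ← nsmul_eq_mul, ← Finset.sum_const, ← Finset.sum_sub_distrib]
        refine (Finset.abs_sum_le_sum_abs _ _).trans ((Finset.sum_le_card_nsmul _ _ (E n)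
          fun y hy => hfar v hv y (Finset.mem_of_mem_erase hy)
            (Finset.ne_of_mem_erase hy).symm).trans ?_)
        rw [nsmul_eq_mul]
        gcongr
        exact Finset.erase_subset _ _
      have h2 := neg_abs_le ((A n).card * U n - ρ / s)
      have h3 := le_abs_self ((A n).card * U n - ρ / s)
      have h4 := hU0 n
      simp only [hδ₁]
      rw [abs_le] at h1 ⊢
      constructor <;> linarith
    · intro v hv hvx
      have h1 := hfar v hv x hx hvx
      have h4 := hU0 n
      change |distGreen n (l n) (hammingDist v x)| ≤ _
      rw [abs_le] at h1 ⊢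
      constructor <;> linarith

end asymptotics

/-! ### Moments and convergence in law on the unit interval -/

theorem integrable_pow_of_ae_mem_Icc {μ : Measure ℝ} [IsProbabilityMeasure μ]
    (hμ : ∀ᵐ u ∂μ, u ∈ Set.Icc (0 : ℝ) 1) (k : ℕ) : Integrable (fun u : ℝ => u ^ k) μ := by
  refine Integrable.of_bound (by fun_prop) 1 ?_
  filter_upwards [hμ] with u hu
  rw [Real.norm_eq_abs, abs_of_nonneg (pow_nonneg hu.1 k)]
  exact pow_le_one₀ hu.1 hu.2

theorem integral_polynomial_eval {μ : Measure ℝ} [IsProbabilityMeasure μ]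
    (hμ : ∀ᵐ u ∂μ, u ∈ Set.Icc (0 : ℝ) 1) (p : Polynomial ℝ) :
    ∫ u, p.eval u ∂μ = ∑ k ∈ Finset.range (p.natDegree + 1), p.coeff k * ∫ u, u ^ k ∂μ := by
  simp only [Polynomial.eval_eq_sum_range]
  rw [integral_finsetSum _ fun k _ => (integrable_pow_of_ae_mem_Icc hμ k).const_mul _]
  simp only [integral_const_mul]

/-- The method of moments for probability measures on `[0, 1]`. -/
theorem tendsto_probabilityMeasure_of_tendsto_moments {μ : ℕ → ProbabilityMeasure ℝ}
    {ν : ProbabilityMeasure ℝ} (hμ : ∀ n, ∀ᵐ u ∂(μ n : Measure ℝ), u ∈ Set.Icc (0 : ℝ) 1)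
    (hν : ∀ᵐ u ∂(ν : Measure ℝ), u ∈ Set.Icc (0 : ℝ) 1)
    (h : ∀ k : ℕ, Tendsto (fun n => ∫ u, u ^ k ∂(μ n : Measure ℝ)) atTop
      (𝓝 (∫ u, u ^ k ∂(ν : Measure ℝ)))) : Tendsto μ atTop (𝓝 ν) := by
  rw [ProbabilityMeasure.tendsto_iff_forall_integral_tendsto]
  intro f
  rw [Metric.tendsto_atTop]
  intro ε hε
  -- By Weierstrass, convergence of moments passes from polynomials to every continuous test
  -- function, since all the laws live on [0, 1].
  obtain ⟨p, hp⟩ := exists_polynomial_near_of_continuousOn 0 1 f f.continuous.continuousOn (ε / 4)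
    (by positivity)
  have hclose : ∀ τ : ProbabilityMeasure ℝ, (∀ᵐ u ∂(τ : Measure ℝ), u ∈ Set.Icc (0 : ℝ) 1) →
      |∫ u, p.eval u ∂(τ : Measure ℝ) - ∫ u, f u ∂(τ : Measure ℝ)| ≤ ε / 4 := by
    intro τ hτ
    have hpi : Integrable (fun u => p.eval u) (τ : Measure ℝ) := by
      simp only [Polynomial.eval_eq_sum_range]
      exact integrable_finsetSum _ fun k _ => (integrable_pow_of_ae_mem_Icc hτ k).const_mul _
    rw [← integral_sub hpi (f.integrable _), ← Real.norm_eq_abs]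
    refine (norm_integral_le_of_norm_le_const (C := ε / 4) ?_).trans (by simp)
    filter_upwards [hτ] with u hu
    exact (hp u hu).le
  have hpol : Tendsto (fun n => ∫ u, p.eval u ∂(μ n : Measure ℝ)) atTop
      (𝓝 (∫ u, p.eval u ∂(ν : Measure ℝ))) := by
    simp only [fun n => integral_polynomial_eval (hμ n) p, integral_polynomial_eval hν p]
    exact tendsto_finsetSum _ fun k _ => (h k).const_mul _
  obtain ⟨N, hN⟩ := Metric.tendsto_atTop.1 hpol (ε / 4) (by positivity)
  refine ⟨N, fun n hn => ?_⟩
  have h1 := hN n hn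
  have h2 := hclose _ (hμ n)
  have h3 := hclose _ hν
  rw [Real.dist_eq, abs_lt] at *
  rw [abs_le] at h2 h3
  constructor <;> linarith

/-- The law of `U ^ (1 / ρ)` for `U` uniformly distributed on `[0, 1]`. -/
theorem exists_probabilityMeasure_power_law {ρ : ℝ} (hρ : 0 < ρ) :
    ∃ ν : ProbabilityMeasure ℝ, (∀ᵐ u ∂(ν : Measure ℝ), u ∈ Set.Icc (0 : ℝ) 1) ∧
      (∀ k : ℕ, ∫ u, u ^ k ∂(ν : Measure ℝ) = ρ / (k + ρ)) ∧
      ∀ c : ℝ, 0 < c → c ≤ 1 → (ν : Measure ℝ) {c} = 0 ∧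
        (ν : Measure ℝ) (Set.Iio c) = ENNReal.ofReal (c ^ ρ) := by
  have hm : Measurable fun v : ℝ => v ^ (1 / ρ) := by fun_prop
  have hprob : IsProbabilityMeasure ((volume : Measure ℝ).restrict (Set.Ioc 0 1)) :=
    ⟨by simp⟩
  refine ⟨⟨((volume : Measure ℝ).restrict (Set.Ioc 0 1)).map fun v => v ^ (1 / ρ),
    Measure.isProbabilityMeasure_map hm.aemeasurable⟩, ?_, ?_, ?_⟩
  · simp only [ProbabilityMeasure.coe_mk]
    refine (ae_map_iff hm.aemeasurable measurableSet_Icc).2 ?_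
    refine (ae_restrict_iff' measurableSet_Ioc).2 (Eventually.of_forall fun v hv => ?_)
    exact ⟨Real.rpow_nonneg hv.1.le _, Real.rpow_le_one hv.1.le hv.2 (by positivity)⟩
  · intro k
    simp only [ProbabilityMeasure.coe_mk]
    rw [integral_map hm.aemeasurable (by fun_prop)]
    have : ∀ v ∈ Set.Ioc (0 : ℝ) 1, (v ^ (1 / ρ)) ^ k = v ^ ((k : ℝ) / ρ) := by
      intro v hv
      rw [← Real.rpow_natCast, ← Real.rpow_mul hv.1.le]
      congr 1
      ring
    have hk : 0 ≤ (k : ℝ) / ρ := by positivity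
    rw [setIntegral_congr_fun measurableSet_Ioc this,
      ← intervalIntegral.integral_of_le zero_le_one, integral_rpow (Or.inl (by linarith)),
      Real.one_rpow, Real.zero_rpow (by positivity)]
    field_simp
    ring
  · intro c hc hc1
    have hcρ : c ^ ρ ≤ 1 := Real.rpow_le_one hc.le hc1 hρ.le
    simp only [ProbabilityMeasure.coe_mk]
    rw [Measure.map_apply hm (measurableSet_singleton c), Measure.map_apply hm measurableSet_Iio,
      Measure.restrict_apply (hm (measurableSet_singleton c)),
      Measure.restrict_apply (hm measurableSet_Iio)]
    constructor
    · refine measure_mono_null (t := {c ^ ρ}) ?_ (by simp)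
      rintro v ⟨hv, hv0, hv1⟩
      have hv' : v ^ (1 / ρ) = c := hv
      rw [Set.mem_singleton_iff, ← hv', ← Real.rpow_mul hv0.le, one_div_mul_cancel hρ.ne',
        Real.rpow_one]
    · have : (fun v : ℝ => v ^ (1 / ρ)) ⁻¹' Set.Iio c ∩ Set.Ioc 0 1 = Set.Ioo 0 (c ^ ρ) := by
        ext v
        simp only [Set.mem_inter_iff, Set.mem_preimage, Set.mem_Iio, Set.mem_Ioc, Set.mem_Ioo]
        constructor
        · rintro ⟨h1, h2, h3⟩
          refine ⟨h2, ?_⟩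
          have := Real.rpow_lt_rpow (Real.rpow_nonneg h2.le _) h1 hρ
          rwa [← Real.rpow_mul h2.le, one_div_mul_cancel hρ.ne', Real.rpow_one] at this
        · rintro ⟨h1, h2⟩
          refine ⟨?_, h1, (h2.trans_le hcρ).le⟩
          have := Real.rpow_lt_rpow h1.le h2 (one_div_pos.2 hρ)
          rwa [← Real.rpow_mul hc.le, mul_one_div_cancel hρ.ne', Real.rpow_one] at this
      rw [this, Real.volume_Ioo, sub_zero]

/-- The limiting moments are those of U^(1/ρ), whose law has no atom at c, so the portmanteau
theorem applies to (-∞, c). -/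
theorem tendsto_measureReal_lt_of_tendsto_moments {Ω : ℕ → Type*} [∀ n, MeasurableSpace (Ω n)]
    {P : (n : ℕ) → Measure (Ω n)} [∀ n, IsProbabilityMeasure (P n)] {U : (n : ℕ) → Ω n → ℝ}
    (hU : ∀ n, Measurable (U n)) (hU01 : ∀ n ω, U n ω ∈ Set.Icc (0 : ℝ) 1) {ρ : ℝ} (hρ : 0 < ρ)
    (h : ∀ k : ℕ, Tendsto (fun n => ∫ ω, U n ω ^ k ∂(P n)) atTop (𝓝 (ρ / (k + ρ))))
    {c : ℝ} (hc : 0 < c) (hc1 : c ≤ 1) :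
    Tendsto (fun n => (P n).real {ω | U n ω < c}) atTop (𝓝 (c ^ ρ)) := by
  obtain ⟨ν, hν01, hνk, hνc⟩ := exists_probabilityMeasure_power_law hρ
  have hlim := tendsto_probabilityMeasure_of_tendsto_moments
    (μ := fun n => ⟨(P n).map (U n), Measure.isProbabilityMeasure_map (hU n).aemeasurable⟩)
    (ν := ν) (fun n => ?_) hν01 fun k => ?_
  · have h1 := ProbabilityMeasure.tendsto_measure_of_null_frontier_of_tendsto' hlim
      (E := Set.Iio c) (by rw [frontier_Iio]; exact (hνc c hc hc1).1)
    have h2 := (ENNReal.tendsto_toReal (measure_ne_top _ _)).comp h1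
    rw [(hνc c hc hc1).2, ENNReal.toReal_ofReal (by positivity)] at h2
    refine h2.congr fun n => ?_
    simp only [Function.comp_apply, ProbabilityMeasure.coe_mk]
    rw [Measure.map_apply (hU n) measurableSet_Iio]
    rfl
  · simp only [ProbabilityMeasure.coe_mk]
    exact (ae_map_iff (hU n).aemeasurable measurableSet_Icc).2 (Eventually.of_forall (hU01 n))
  · simp only [ProbabilityMeasure.coe_mk, hνk]
    refine (h k).congr fun n => ?_
    rw [integral_map (hU n).aemeasurable (by fun_prop)]

/-! ### From Laplace transforms to tails, uniformly in the starting point -/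

theorem tendsto_iSup_abs_of_eventually_le {V : ℕ → Type*} {A : (n : ℕ) → Finset (V n)}
    {F : (n : ℕ) → V n → ℝ} (h : ∀ ε > 0, ∀ᶠ n in atTop, ∀ x ∈ A n, |F n x| ≤ ε) :
    Tendsto (fun n => ⨆ x : {x // x ∈ A n}, |F n x|) atTop (𝓝 0) := by
  rw [Metric.tendsto_nhds]
  intro ε hε
  filter_upwards [h (ε / 2) (by positivity)] with n hn
  rw [Real.dist_eq, sub_zero, abs_of_nonneg (Real.iSup_nonneg fun _ => abs_nonneg _)]
  exact (Real.iSup_le (fun x : {x // x ∈ A n} => hn x x.2) (half_pos hε).le).trans_lt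
    (half_lt_self hε)

/-- The exponent 0 is excluded because the value at ∞ is 0 even when a = 0. -/
theorem expNeg_pow (a : ℝ) (h : ℕ∞) {k : ℕ} (hk : k ≠ 0) : expNeg a h ^ k = expNeg (k * a) h := by
  unfold expNeg
  split_ifs
  · exact zero_pow hk
  · rw [← Real.exp_nat_mul]
    congr 1
    ring

/-- Turns tails of H into the distribution function of a [0, 1]-valued variable, to which the method
of moments applies; H = ∞ corresponds to the value 0. -/
theorem expNeg_lt_exp_iff {N t : ℝ} (hN : 0 < N) (ht : 0 ≤ t) (h : ℕ∞) :
    expNeg (1 / N) h < Real.exp (-t) ↔ ENNReal.ofReal (t * N) < (h : ℝ≥0∞) := by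
  induction h using ENat.recTopCoe with
  | top => simp [expNeg, Real.exp_pos]
  | coe m =>
    rw [expNeg, if_neg (ENat.natCast_ne_top m), ENat.toNat_natCast, Real.exp_lt_exp, neg_lt_neg_iff,
      ENat.toENNReal_coe, ← ENNReal.ofReal_natCast,
      ENNReal.ofReal_lt_ofReal_iff_of_nonneg (by positivity), one_div_mul_eq_div, lt_div_iff₀ hN]

theorem expNeg_anti {a : ℝ} (ha : 0 ≤ a) (h : ℕ∞) : expNeg a h ≤ expNeg 0 h := by
  unfold expNeg
  split_ifs
  · rfl
  · rw [Real.exp_le_exp]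
    simp only [zero_mul, neg_zero, Left.neg_nonpos_iff]
    positivity

section asymptotics

variable {γ η ρ : ℝ} {A : (n : ℕ) → Finset (Cube n)} {dens : ℕ → ℝ} {Ω : ℕ → Type*}
  [∀ n, MeasurableSpace (Ω n)] {P : (n : ℕ) → Cube n → Measure (Ω n)}
  {Y : (n : ℕ) → Cube n → ℕ → Ω n → Cube n}

/-- What remains is s = 0, where the transform is P(H < ∞). It lies between 1 and the transform at
any positive parameter. -/
theorem eventually_abs_integral_expNeg_sub_le (hρ : 0 < ρ)
    (hY : ∀ n : ℕ, 1 ≤ n → ∀ x : Cube n, IsSimpleRandomWalk (hypercube n) (P n x) (Y n x) x)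
    (h : ∀ s > 0, ∃ δ : ℕ → ℝ, Tendsto δ atTop (𝓝 0) ∧ ∀ᶠ n : ℕ in atTop, ∀ x ∈ A n,
      |(∫ ω, expNeg (s / (2 : ℝ) ^ (γ * (n : ℝ)))
          (hittingTime (Y n x) ((A n : Set (Cube n)) \ {x}) ω) ∂(P n x)) - ρ / (s + ρ)| ≤ δ n)
    {s : ℝ} (hs : 0 ≤ s) {ε : ℝ} (hε : 0 < ε) :
    ∀ᶠ n : ℕ in atTop, ∀ x ∈ A n, |(∫ ω, expNeg (s / (2 : ℝ) ^ (γ * (n : ℝ)))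
      (hittingTime (Y n x) ((A n : Set (Cube n)) \ {x}) ω) ∂(P n x)) - ρ / (s + ρ)| ≤ ε := by
  rcases hs.eq_or_lt with rfl | hs
  -- At this parameter the limit is 1/(1 + ε/2) ≥ 1 - ε/2.
  · obtain ⟨δ, hδ, hb⟩ := h (ρ * ε / 2) (by positivity)
    filter_upwards [hb, hδ.eventually_le_const (by positivity : 0 < ε / 2),
      eventually_ge_atTop 1] with n hn hδn hn1 x hx
    have hW := hY n hn1 x
    have := hW.isProbabilityMeasure
    set B := (A n : Set (Cube n)) \ {x}
    have h1 := (hn x hx).trans hδn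
    set a := ρ * ε / 2 / (2 : ℝ) ^ (γ * (n : ℝ)) with ha
    have ha0 : 0 ≤ a := by positivity
    have h2 : ∫ ω, expNeg a (hittingTime (Y n x) B ω) ∂(P n x) ≤
        ∫ ω, expNeg 0 (hittingTime (Y n x) B ω) ∂(P n x) :=
      integral_mono (hW.integrable_expNeg_hittingTime B ha0)
        (hW.integrable_expNeg_hittingTime B le_rfl) fun ω => expNeg_anti ha0 _
    have h3 : ∫ ω, expNeg 0 (hittingTime (Y n x) B ω) ∂(P n x) ≤ 1 := by
      refine (integral_mono (hW.integrable_expNeg_hittingTime B le_rfl) (integrable_const (1 : ℝ))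
        fun ω => expNeg_le_one le_rfl _).trans (by simp)
    have h4 : 1 - ε / 2 ≤ ρ / (ρ * ε / 2 + ρ) := by
      rw [le_div_iff₀ (by positivity)]
      nlinarith [mul_pos hρ (mul_pos hε hε)]
    rw [zero_div, zero_add, div_self hρ.ne']
    rw [abs_le] at h1 ⊢
    constructor <;> linarith
  · obtain ⟨δ, hδ, hb⟩ := h s hs
    filter_upwards [hb, hδ.eventually_le_const hε] with n hn hδn x hx
    exact (hn x hx).trans hδn

theorem tendsto_measureReal_lt_hittingTime (hρ : 0 < ρ)
    (hY : ∀ n : ℕ, 1 ≤ n → ∀ x : Cube n, IsSimpleRandomWalk (hypercube n) (P n x) (Y n x) x)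
    (h : ∀ s ≥ 0, ∀ ε > 0, ∀ᶠ n : ℕ in atTop, ∀ x ∈ A n,
      |(∫ ω, expNeg (s / (2 : ℝ) ^ (γ * (n : ℝ)))
          (hittingTime (Y n x) ((A n : Set (Cube n)) \ {x}) ω) ∂(P n x)) - ρ / (s + ρ)| ≤ ε)
    (x : (n : ℕ) → Cube n) (hx : ∀ᶠ n in atTop, x n ∈ A n) {t : ℝ} (ht : 0 ≤ t) :
    Tendsto (fun n : ℕ => (P n (x n)).real {ω | ENNReal.ofReal (t * (2 : ℝ) ^ (γ * (n : ℝ))) <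
      ((hittingTime (Y n (x n)) ((A n : Set (Cube n)) \ {x n}) ω : ℕ∞) : ℝ≥0∞)}) atTop
      (𝓝 (Real.exp (-(ρ * t)))) := by
  have hexp : Real.exp (-(ρ * t)) = Real.exp (-t) ^ ρ := by
    rw [← Real.exp_mul]
    congr 1
    ring
  have hset : ∀ n : ℕ, {ω | ENNReal.ofReal (t * (2 : ℝ) ^ (γ * (n : ℝ))) <
      ((hittingTime (Y n (x n)) ((A n : Set (Cube n)) \ {x n}) ω : ℕ∞) : ℝ≥0∞)} =
      {ω | expNeg (1 / (2 : ℝ) ^ (γ * (n : ℝ)))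
        (hittingTime (Y n (x n)) ((A n : Set (Cube n)) \ {x n}) ω) < Real.exp (-t)} := by
    intro n
    ext ω
    exact (expNeg_lt_exp_iff (by positivity) ht _).symm
  simp only [hset]
  -- The shift avoids n = 0, where no walk is given.
  rw [hexp, ← tendsto_add_atTop_iff_nat 1]
  have hprob : ∀ n, IsProbabilityMeasure (P (n + 1) (x (n + 1))) := fun n =>
    (hY (n + 1) (by omega) _).isProbabilityMeasure
  refine tendsto_measureReal_lt_of_tendsto_moments (Ω := fun n => Ω (n + 1))
    (P := fun n => P (n + 1) (x (n + 1))) (U := fun n ω =>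
      expNeg (1 / (2 : ℝ) ^ (γ * ((n + 1 : ℕ) : ℝ))) (hittingTime (Y (n + 1) (x (n + 1)))
        ((A (n + 1) : Set (Cube (n + 1))) \ {x (n + 1)}) ω))
    (fun n => (hY (n + 1) (by omega) _).measurable_expNeg_hittingTime _ _)
    (fun n ω => ⟨expNeg_nonneg _ _, expNeg_le_one (by positivity) _⟩) hρ (fun k => ?_)
    (Real.exp_pos _) (Real.exp_le_one_iff.2 (by linarith))
  rcases Nat.eq_zero_or_pos k with rfl | hk
  · simp [hρ.ne']
  · simp only [expNeg_pow _ _ hk.ne', mul_one_div]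
    rw [tendsto_add_atTop_iff_nat (f := fun n : ℕ => ∫ ω, expNeg ((k : ℝ) / (2 : ℝ) ^ (γ * (n : ℝ)))
      (hittingTime (Y n (x n)) ((A n : Set (Cube n)) \ {x n}) ω) ∂(P n (x n))) 1]
    rw [Metric.tendsto_nhds]
    intro ε hε
    filter_upwards [h k (Nat.cast_nonneg k) (ε / 2) (by positivity), hx] with n hn hxn
    rw [Real.dist_eq]
    exact (hn (x n) hxn).trans_lt (by linarith)

end asymptotics

/-- Let x n be a point of A n violating p whenever there is one: if p holds along this sequence, no
violation is left. -/
theorem eventually_forall_mem_of_forall_seq {V : ℕ → Type*} [∀ n, Nonempty (V n)]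
    {A : (n : ℕ) → Finset (V n)} (hA : ∀ᶠ n in atTop, (A n).Nonempty)
    {p : (n : ℕ) → V n → Prop}
    (h : ∀ x : (n : ℕ) → V n, (∀ᶠ n in atTop, x n ∈ A n) → ∀ᶠ n in atTop, p n (x n)) :
    ∀ᶠ n in atTop, ∀ x ∈ A n, p n x := by
  have hch : ∀ n, ∃ x : V n, ((A n).Nonempty → x ∈ A n) ∧ (p n x → ∀ y ∈ A n, p n y) := by
    intro n
    by_cases hbad : ∃ x ∈ A n, ¬ p n x
    · obtain ⟨x, hx, hpx⟩ := hbad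
      exact ⟨x, fun _ => hx, fun hp => absurd hp hpx⟩
    · push Not at hbad
      by_cases hne : (A n).Nonempty
      · obtain ⟨x, hx⟩ := hne
        exact ⟨x, fun _ => hx, fun _ => hbad⟩
      · exact ⟨Classical.arbitrary _, fun h => absurd h hne, fun _ => hbad⟩
  choose x hx hp using hch
  filter_upwards [h x (hA.mono fun n hn => hx n hn)] with n hn
  exact hp n hn

/-! ### The entropy condition and the theorem -/

theorem binEntropy_add_bernoulliRate (u : ℝ) :
    Real.binEntropy u + bernoulliRate u = Real.log 2 := by
  rw [Real.binEntropy, bernoulliRate, Real.log_inv, Real.log_inv]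
  ring

theorem propositionp
    (γ : ℝ) (hγ : 1 / 2 < γ) (hγ' : γ < 1)
    -- `w = ω(γ)` is the solution in `[0, 1/2]` of `I(w) = (2γ - 1) log 2`
    (w : ℝ) (hw : 0 ≤ w) (hw' : w ≤ 1 / 2)
    (hwγ : bernoulliRate w = (2 * γ - 1) * Real.log 2)
    (ρ : ℝ) (hρ : 0 < ρ)
    (A : (n : ℕ) → Finset (Cube n)) (dens : ℕ → ℝ)
    (hcard : ∀ n : ℕ, 1 ≤ n → ((A n).card : ℝ) = dens n * 2 ^ n)
    (hdens : Tendsto (fun n : ℕ => dens n * (2 : ℝ) ^ (γ * (n : ℝ))) atTop (𝓝 ρ))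
    (ε : ℝ) (hε : 0 < ε)
    (hdist : ∀ n : ℕ, 1 ≤ n → ∀ x ∈ A n, ∀ y ∈ A n, x ≠ y →
      (w + ε) * (n : ℝ) ≤ (hammingDist x y : ℝ))
    -- for every `n ≥ 1` and every vertex `x`, a simple random walk `Y n x` started at `x`
    {Ω : ℕ → Type*} [∀ n, MeasurableSpace (Ω n)]
    (P : (n : ℕ) → Cube n → Measure (Ω n)) (Y : (n : ℕ) → Cube n → ℕ → Ω n → Cube n)
    (hY : ∀ n : ℕ, 1 ≤ n → ∀ x : Cube n,
      IsSimpleRandomWalk (hypercube n) (P n x) (Y n x) x) :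
    -- uniform convergence of the Laplace transforms
    (∀ s : ℝ, 0 ≤ s →
      Tendsto (fun n : ℕ => ⨆ x : {x // x ∈ A n},
        |(∫ ω, expNeg (s / (2 : ℝ) ^ (γ * (n : ℝ)))
            (hittingTime (Y n x) ((A n : Set (Cube n)) \ {(x : Cube n)}) ω) ∂(P n x))
          - ρ / (s + ρ)|) atTop (𝓝 0)) ∧
    -- uniform convergence of the tails to those of the exponential law with mean `1 / ρ`
    (∀ t : ℝ, 0 ≤ t →
      Tendsto (fun n : ℕ => ⨆ x : {x // x ∈ A n},
        |(P n x).real {ω | ENNReal.ofReal (t * (2 : ℝ) ^ (γ * (n : ℝ))) <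
            ((hittingTime (Y n x) ((A n : Set (Cube n)) \ {(x : Cube n)}) ω : ℕ∞) : ℝ≥0∞)}
          - Real.exp (-(ρ * t))|) atTop (𝓝 0)) := by

  have hlog : 0 < Real.log 2 := Real.log_pos one_lt_two
  have hent := binEntropy_add_bernoulliRate w
  -- At 1/2 the rate function vanishes, whereas (2γ - 1) log 2 > 0.
  have hw2 : w < 2⁻¹ := by
    refine lt_of_le_of_ne (by linarith) fun h => ?_
    have h1 := Real.binEntropy_eq_log_two.2 h
    have h2 : 0 < (2 * γ - 1) * Real.log 2 := mul_pos (by linarith) hlog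
    linarith
  -- The cap keeps η below 1/2, where entropy is strictly increasing, so h(η) > h(w) = 2(1 - γ) log
  -- 2.
  set η := min (w + ε) ((w + 2⁻¹) / 2) with hη
  have hwη : w < η := lt_min (by linarith) (by linarith)
  have hη2 : η < 2⁻¹ := (min_le_right _ _).trans_lt (by linarith)
  have hη0 : 0 < η := hw.trans_lt hwη
  have hentη : 2 * (1 - γ) * Real.log 2 < Real.binEntropy η := by
    have := Real.binEntropy_strictMonoOn ⟨hw, hw2.le⟩ ⟨hη0.le, hη2.le⟩ hwη
    linarith
  have hdist' : ∀ n : ℕ, 1 ≤ n → ∀ x ∈ A n, ∀ y ∈ A n, x ≠ y → η * n ≤ hammingDist x y :=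
    fun n hn x hx y hy hxy => (mul_le_mul_of_nonneg_right (min_le_left _ _)
      (Nat.cast_nonneg n)).trans (hdist n hn x hx y hy hxy)
  have hLap : ∀ s ≥ 0, ∀ e > 0, ∀ᶠ n : ℕ in atTop, ∀ x ∈ A n,
      |(∫ ω, expNeg (s / (2 : ℝ) ^ (γ * (n : ℝ)))
          (hittingTime (Y n x) ((A n : Set (Cube n)) \ {x}) ω) ∂(P n x)) - ρ / (s + ρ)| ≤ e :=
    fun s hs e he => eventually_abs_integral_expNeg_sub_le hρ hY (fun s hs =>
      exists_abs_integral_expNeg_sub_le_of_pos (by linarith) hγ' hη0 hη2 hentη hρ hcard hdens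
        hdist' hY hs) hs he
  refine ⟨fun s hs => tendsto_iSup_abs_of_eventually_le (V := Cube) (A := A)
    (F := fun n x => (∫ ω, expNeg (s / (2 : ℝ) ^ (γ * (n : ℝ)))
      (hittingTime (Y n x) ((A n : Set (Cube n)) \ {x}) ω) ∂(P n x)) - ρ / (s + ρ)) (hLap s hs),
    fun t ht => tendsto_iSup_abs_of_eventually_le (V := Cube) (A := A)
      (F := fun n x => (P n x).real {ω | ENNReal.ofReal (t * (2 : ℝ) ^ (γ * (n : ℝ))) <
        ((hittingTime (Y n x) ((A n : Set (Cube n)) \ {x}) ω : ℕ∞) : ℝ≥0∞)} -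
          Real.exp (-(ρ * t))) fun e he => ?_⟩
  have hne : ∀ᶠ n in atTop, (A n).Nonempty := by
    filter_upwards [hdens.eventually_const_lt hρ, eventually_ge_atTop 1] with n hn hn1
    have h1 : 0 < dens n := (pos_iff_pos_of_mul_pos hn).2 (by positivity)
    have h2 : (0 : ℝ) < (A n).card := by rw [hcard n hn1]; positivity
    exact Finset.card_pos.1 (by exact_mod_cast h2)
  refine eventually_forall_mem_of_forall_seq (V := Cube) (A := A) hne fun x hx => ?_
  filter_upwards [Metric.tendsto_nhds.1
    (tendsto_measureReal_lt_hittingTime hρ hY hLap x hx ht) e he] with n hn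
  exact (Real.dist_eq _ _ ▸ hn).le
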